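/- For an integer $n \ge 0$ let $p(n)$ be the number of partitions of $n$, that is, of non-increasing finite sequences of positive integers with sum $n$. Then $p$ is Benford: for every integer base $k \ge 2$ and every integer $d \ge 1$, $$\lim_{x\to\infty} \frac{\#\{\,0 \le n \le x : \text{the base-}k\text{ expansion of } p(n) \text{ begins with the base-}k\text{ expansion of } d\,\}}{x} = \log_k(d+1)-\log_k(d),$$ where $n$ ranges over integers and $x$ over real numbers. -/

import Mathlib

/-- The partition function: the number of partitions of `n`. -/
def partitionFunction (n : ℕ) : ℕ := Fintype.card (Nat.Partition n)

/-- The base-`k` expansion of `m` begins with the base-`k` expansion of `d`.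
`Nat.digits` lists digits from the least significant one upwards, so an initial string
of the usual expansion is a suffix of this list. -/
def BeginsWith (k d m : ℕ) : Prop := Nat.digits k d <:+ Nat.digits k m

/-- The number of indices `n ≤ x` such that the base-`k` expansion of `a n` begins with the digit
string of `d`, divided by `x`. -/
noncomputable def digitFrequency (d : ℕ) (x : ℝ) (k : ℕ) (a : ℕ → ℕ) : ℝ :=
  ({n : ℕ | (n : ℝ) ≤ x ∧ BeginsWith k d (a n)}.ncard : ℝ) / x

/-- A sequence is Benford if, in every base `k ≥ 2` and for every initial digit string (that is, the
base-`k` expansion of some `d ≥ 1`), the frequency of that string tends to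
`log_k (d + 1) - log_k d`. -/
def IsBenford (a : ℕ → ℕ) : Prop :=
  ∀ k : ℕ, 2 ≤ k → ∀ d : ℕ, 1 ≤ d →
    Filter.Tendsto (fun x : ℝ => digitFrequency d x k a) Filter.atTop
      (nhds (Real.logb (k : ℝ) ((d : ℝ) + 1) - Real.logb (k : ℝ) (d : ℝ)))

/-!
The leading digits of `p(n)` are governed by `log p(n)` modulo `log k`, so it is enough to know how
`p` grows over windows of length comparable to `√n`. The whole arithmetic input is the relation

  `p(n + t√n) / p(n) → exp (C t)` for every fixed real `t`,   (`tendsto_partitionRatio`)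

with a constant `C > 0`. It follows that the number of `n` with `y ≤ p(n) < r y` is asymptotic to
`(log r / C) √N`, where `N` is the first index with `p(N) ≥ y` (`tendsto_firstIndex_sub`). The
indices `n` for which `p(n)` begins with `d` form the intervals given by
`d k ^ j ≤ p(n) < (d + 1) k ^ j`, and those intervals occupy asymptotically the proportion
`log ((d + 1) / d) / log k` of the blocks given by `d k ^ j ≤ p(n) < d k ^ (j + 1)`. As consecutive
blocks have starting points with ratio tending to `1`, a Stolz–Cesàro argument turns this into the
natural density (`tendsto_density_iUnion_Ico`).

The growth relation is obtained without modular forms or the circle method, from Euler's recurrence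
`n p(n) = ∑ σ(k) p(n - k)` (`mul_partitionFunction`) and `∑_{k ≤ y} σ(k) ∼ c y²`
(`tendsto_sigmaSum_div_sq`). The recurrence and the monotonicity of `p` give exponential decay of
`p(n - u√n) / p(n)` in `u` (`partitionReal_sub_mul_sqrt_le`) and local boundedness of
`p(n + t√n) / p(n)` (`exists_partitionReal_add_le`). Hence along every ultrafilter tending to
infinity the ratios converge to some monotone `g` with `g 0 = 1`, and the recurrence passes to the
limit as the renewal equation `g(t) = 2c ∫_{v ≤ t} (t - v) g(v) dv`. So `g'' = 2c g`, and decay at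
`-∞` leaves only `g(t) = exp (√(2c) t)` (`eq_exp_of_renewal`). Since this does not depend on the
ultrafilter, the ratios converge.
-/

open Filter Topology Finset

/-! ### Euler's recurrence for the partition function -/

/-- Removing one part `d` from each partition of `n` that has one gives a recursion for the total
multiplicity of `d` among the partitions of `n`. -/
theorem sum_count_eq_add {n d : ℕ} (hd : 1 ≤ d) (hdn : d ≤ n) :
    ∑ l : n.Partition, l.parts.count d
      = partitionFunction (n - d) + ∑ l : (n - d).Partition, l.parts.count d := by
  classical
  have h1 : ∑ l : n.Partition, l.parts.count d
      = ∑ l : {l : n.Partition // d ∈ l.parts}, l.1.parts.count d := by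
    rw [← Finset.sum_subtype (univ.filter fun l : n.Partition => d ∈ l.parts) (by simp)
      fun l : n.Partition => l.parts.count d]
    refine (Finset.sum_subset (Finset.filter_subset _ _) fun l _ hl => ?_).symm
    simpa using hl
  rw [h1, ← (Nat.Partition.partitionWithPartEquiv hd hdn).symm.sum_comp]
  simp [Finset.sum_add_distrib, partitionFunction, add_comm]

theorem sum_count_eq_sum_dvd {d : ℕ} (hd : 1 ≤ d) (n : ℕ) :
    ∑ l : n.Partition, l.parts.count d
      = ∑ k ∈ Ioc 0 n with d ∣ k, partitionFunction (n - k) := by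
  induction n using Nat.strong_induction_on with
  | _ n ih =>
    rcases lt_or_ge n d with h | h
    · rw [Finset.sum_eq_zero, Finset.sum_eq_zero]
      · intro k hk
        simp only [mem_filter, mem_Ioc] at hk
        exact absurd (Nat.le_of_dvd hk.1.1 hk.2) (by omega)
      · intro l _
        refine Multiset.count_eq_zero.2 fun hm => ?_
        have := l.le_of_mem_parts hm
        omega
    · rw [sum_count_eq_add hd h, ih (n - d) (by omega)]
      have : (Ioc 0 n).filter (d ∣ ·)
          = insert d (((Ioc 0 (n - d)).filter (d ∣ ·)).map (addRightEmbedding d)) := by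
        ext k
        simp only [mem_filter, mem_Ioc, mem_insert, Finset.mem_map, addRightEmbedding_apply]
        constructor
        · rintro ⟨⟨h1, h2⟩, h3⟩
          rcases eq_or_ne k d with rfl | hne
          · exact Or.inl rfl
          · have := Nat.le_of_dvd h1 h3
            exact Or.inr ⟨k - d, ⟨⟨by omega, by omega⟩, Nat.dvd_sub h3 dvd_rfl⟩, by omega⟩
        · rintro (rfl | ⟨a, ⟨⟨h1, h2⟩, h3⟩, rfl⟩)
          · exact ⟨⟨by omega, h⟩, dvd_rfl⟩
          · exact ⟨⟨by omega, by omega⟩, dvd_add h3 dvd_rfl⟩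
      rw [this, Finset.sum_insert, Finset.sum_map]
      · congr 1
        refine Finset.sum_congr rfl fun k _ => ?_
        rw [addRightEmbedding_apply]
        congr 1
        omega
      · simp

theorem sum_mul_count_parts {n : ℕ} (l : n.Partition) :
    ∑ d ∈ Ioc 0 n, d * l.parts.count d = n := by
  classical
  have h := Finset.sum_multiset_count l.parts
  rw [l.parts_sum] at h
  conv_rhs => rw [h]
  symm
  rw [Finset.sum_subset (s₂ := Ioc 0 n)]
  · exact Finset.sum_congr rfl fun d _ => by rw [smul_eq_mul, mul_comm]
  · intro d hd
    rw [Multiset.mem_toFinset] at hd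
    exact mem_Ioc.2 ⟨l.parts_pos hd, l.le_of_mem_parts hd⟩
  · intro d _ hd
    rw [Multiset.mem_toFinset] at hd
    rw [Multiset.count_eq_zero.2 hd, zero_smul]

/-- Euler's recurrence: both sides are the sum of all parts of all partitions of `n`, the right-hand
side being sorted by the value `d` of the part, which occurs `∑_{d ∣ k} p(n - k)` times in total. -/
theorem mul_partitionFunction (n : ℕ) :
    n * partitionFunction n
      = ∑ k ∈ Ioc 0 n, ArithmeticFunction.sigma 1 k * partitionFunction (n - k) := by
  calc n * partitionFunction n
      = ∑ l : n.Partition, ∑ d ∈ Ioc 0 n, d * l.parts.count d := by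
        simp [sum_mul_count_parts, partitionFunction, mul_comm]
    _ = ∑ d ∈ Ioc 0 n, d * ∑ k ∈ Ioc 0 n with d ∣ k, partitionFunction (n - k) := by
        rw [Finset.sum_comm]
        refine Finset.sum_congr rfl fun d hd => ?_
        rw [← Finset.mul_sum, sum_count_eq_sum_dvd (mem_Ioc.1 hd).1]
    _ = ∑ k ∈ Ioc 0 n, ArithmeticFunction.sigma 1 k * partitionFunction (n - k) := by
        simp_rw [Finset.mul_sum, Finset.sum_filter]
        rw [Finset.sum_comm]
        refine Finset.sum_congr rfl fun k hk => ?_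
        rw [ArithmeticFunction.sigma_one_apply, Finset.sum_mul, ← Finset.sum_filter]
        refine Finset.sum_congr ?_ fun _ _ => rfl
        ext d
        simp only [mem_filter, mem_Ioc, Nat.mem_divisors] at hk ⊢
        constructor
        · rintro ⟨_, h⟩
          exact ⟨h, by omega⟩
        · rintro ⟨h, _⟩
          have := Nat.le_of_dvd hk.1 h
          have := Nat.pos_of_dvd_of_pos h hk.1
          exact ⟨⟨by omega, by omega⟩, h⟩

theorem partitionFunction_monotone : Monotone partitionFunction := by
  refine monotone_nat_of_le_succ fun n => ?_
  have e := Nat.Partition.partitionWithPartEquiv (n := n + 1) le_rfl (by omega)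
  have h : partitionFunction n = Fintype.card {l : (n + 1).Partition // 1 ∈ l.parts} := by
    rw [Fintype.card_congr e]; rfl
  rw [h]
  exact Fintype.card_subtype_le _

theorem partitionFunction_pos (n : ℕ) : 0 < partitionFunction n :=
  Fintype.card_pos

/-! ### The partition function of a real variable -/

/-- The partition function of a real variable: `p(⌊x⌋)` for `x ≥ 0`, and `0` for `x < 0`. Vanishing
at negative arguments keeps it monotone and lets the recurrence sum run past `x`. -/
noncomputable def partitionReal (x : ℝ) : ℝ :=
  if x < 0 then 0 else (partitionFunction ⌊x⌋₊ : ℝ)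

theorem partitionReal_of_neg {x : ℝ} (hx : x < 0) : partitionReal x = 0 := if_pos hx

theorem partitionReal_of_nonneg {x : ℝ} (hx : 0 ≤ x) :
    partitionReal x = (partitionFunction ⌊x⌋₊ : ℝ) := if_neg hx.not_gt

theorem partitionReal_natCast (n : ℕ) : partitionReal n = partitionFunction n := by
  rw [partitionReal_of_nonneg n.cast_nonneg, Nat.floor_natCast]

theorem partitionReal_nonneg (x : ℝ) : 0 ≤ partitionReal x := by
  unfold partitionReal
  split_ifs <;> positivity

theorem partitionReal_pos {x : ℝ} (hx : 0 ≤ x) : 0 < partitionReal x := by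
  rw [partitionReal_of_nonneg hx]
  exact_mod_cast partitionFunction_pos _

theorem partitionReal_monotone : Monotone partitionReal := by
  intro x y h
  rcases lt_or_ge x 0 with hx | hx
  · rw [partitionReal_of_neg hx]
    exact partitionReal_nonneg y
  · rw [partitionReal_of_nonneg hx, partitionReal_of_nonneg (hx.trans h)]
    exact_mod_cast partitionFunction_monotone (Nat.floor_le_floor h)

theorem floor_mul_partitionReal {x : ℝ} (hx : 0 ≤ x) :
    (⌊x⌋₊ : ℝ) * partitionReal x
      = ∑ k ∈ Ioc 0 ⌊x⌋₊, (ArithmeticFunction.sigma 1 k : ℝ) * partitionReal (x - k) := by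
  rw [partitionReal_of_nonneg hx]
  have h := congrArg (Nat.cast : ℕ → ℝ) (mul_partitionFunction ⌊x⌋₊)
  push_cast at h
  rw [h]
  refine Finset.sum_congr rfl fun k hk => ?_
  have hk' : (k : ℝ) ≤ x := (Nat.le_floor_iff hx).1 (mem_Ioc.1 hk).2
  rw [partitionReal_of_nonneg (sub_nonneg.2 hk'), Nat.floor_sub_natCast]

/-! ### The summatory function of the sum of divisors -/

/-- The summatory function of the divisor sum `σ`, as a function of a real variable. -/
noncomputable def sigmaSum (y : ℝ) : ℝ :=
  ∑ k ∈ Ioc 0 ⌊y⌋₊, (ArithmeticFunction.sigma 1 k : ℝ)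

/-- The constant `c = ζ(2) / 2` in `∑_{k ≤ y} σ(k) ∼ c y²`. -/
noncomputable def sigmaConst : ℝ := ∑' m : ℕ, 1 / (2 * ((m : ℝ) + 1) ^ 2)

theorem summable_sigmaConst : Summable fun m : ℕ => 1 / (2 * ((m : ℝ) + 1) ^ 2) := by
  have h : Summable fun m : ℕ => 1 / ((m : ℝ) + 1) ^ 2 := by
    have := (summable_nat_add_iff 1).2 (Real.summable_one_div_nat_pow.2 one_lt_two)
    simpa using this
  refine (h.mul_left (1 / 2)).congr fun m => ?_
  field_simp

theorem sigmaConst_pos : 0 < sigmaConst :=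
  summable_sigmaConst.tsum_pos (fun m => by positivity) 0 (by positivity)

theorem sigmaSum_monotone : Monotone sigmaSum := fun x y h =>
  Finset.sum_le_sum_of_subset_of_nonneg
    (Finset.Ioc_subset_Ioc_right (Nat.floor_le_floor h)) fun _ _ _ => by positivity

theorem sigmaSum_zero : sigmaSum 0 = 0 := by simp [sigmaSum]

theorem sum_Ioc_cast (N : ℕ) : ∑ d ∈ Ioc 0 N, (d : ℝ) = N * (N + 1) / 2 := by
  induction N with
  | zero => simp
  | succ N ih =>
    rw [← Finset.sum_Ioc_consecutive _ (Nat.zero_le N) (Nat.le_succ N), ih]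
    simp
    ring

/-- Writing `k = (m + 1) d` and summing over `d` first; the terms with `m + 1 > y` vanish. -/
theorem sigmaSum_eq_tsum (y : ℝ) : sigmaSum y
    = ∑' m : ℕ, ((⌊y / (m + 1)⌋₊ : ℝ) * ((⌊y / (m + 1)⌋₊ : ℝ) + 1) / 2) := by
  set N := ⌊y⌋₊ with hN
  have hdiv : ∀ m : ℕ, ⌊y / (m + 1)⌋₊ = N / (m + 1) := fun m => by
    have := Nat.floor_div_natCast y (m + 1)
    push_cast at this
    exact this
  have h1 : ∑ n ∈ Ioc 0 N, ArithmeticFunction.sigma 1 n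
      = ∑ m ∈ Ioc 0 N, ∑ d ∈ Ioc 0 (N / m), d := by
    rw [← ArithmeticFunction.zeta_mul_pow_eq_sigma, ArithmeticFunction.sum_Ioc_mul_eq_sum_sum]
    refine Finset.sum_congr rfl fun m hm => ?_
    rw [ArithmeticFunction.zeta_apply_ne (by have := (mem_Ioc.1 hm).1; omega), one_mul]
    simp
  have h2 : sigmaSum y = ∑ m ∈ Ioc 0 N, ((N / m : ℕ) : ℝ) * ((N / m : ℕ) + 1) / 2 := by
    have := congrArg (Nat.cast : ℕ → ℝ) h1
    push_cast at this
    rw [sigmaSum, this]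
    exact Finset.sum_congr rfl fun m _ => sum_Ioc_cast _
  rw [h2, tsum_eq_sum (s := range N)]
  · rw [Finset.sum_bij' (fun m _ => m - 1) (fun m _ => m + 1)]
    · intro m hm; simp only [mem_Ioc, mem_range] at hm ⊢; omega
    · intro m hm; simp only [mem_Ioc, mem_range] at hm ⊢; omega
    · intro m hm; simp only [mem_Ioc] at hm; omega
    · intro m hm; simp
    · intro m hm
      simp only [mem_Ioc] at hm
      rw [hdiv, Nat.sub_add_cancel hm.1]
  · intro m hm
    rw [hdiv, Nat.div_eq_of_lt (by simpa using hm)]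
    simp

theorem floor_mul_succ_le {y : ℝ} (hy : 0 ≤ y) (m : ℕ) :
    (⌊y / (m + 1)⌋₊ : ℝ) * ((⌊y / (m + 1)⌋₊ : ℝ) + 1) / 2
      ≤ 2 * y ^ 2 * (1 / (2 * ((m : ℝ) + 1) ^ 2)) := by
  have h1 : (⌊y / (m + 1)⌋₊ : ℝ) ≤ y / (m + 1) := Nat.floor_le (by positivity)
  have h2 : (⌊y / (m + 1)⌋₊ : ℝ) ≤ (⌊y / (m + 1)⌋₊ : ℝ) ^ 2 := by
    exact_mod_cast Nat.le_self_pow two_ne_zero _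
  have h3 : (⌊y / (m + 1)⌋₊ : ℝ) ^ 2 ≤ (y / (m + 1)) ^ 2 := by gcongr
  have h4 : 2 * y ^ 2 * (1 / (2 * ((m : ℝ) + 1) ^ 2)) = (y / (m + 1)) ^ 2 := by
    field_simp
  rw [h4]
  nlinarith

theorem sigmaSum_le {y : ℝ} (hy : 0 ≤ y) : sigmaSum y ≤ 2 * sigmaConst * y ^ 2 := by
  have hs := summable_sigmaConst.mul_left (2 * y ^ 2)
  rw [sigmaSum_eq_tsum, show 2 * sigmaConst * y ^ 2 = 2 * y ^ 2 * sigmaConst by ring, sigmaConst,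
    ← tsum_mul_left]
  exact (Summable.of_nonneg_of_le (fun m => by positivity) (floor_mul_succ_le hy) hs).tsum_le_tsum
    (floor_mul_succ_le hy) hs

theorem le_sigmaSum {y : ℝ} (hy : 1 ≤ y) : y * (y - 1) / 2 ≤ sigmaSum y := by
  have h1 : y - 1 < ⌊y⌋₊ := Nat.sub_one_lt_floor y
  calc y * (y - 1) / 2 ≤ (⌊y⌋₊ : ℝ) * (⌊y⌋₊ + 1) / 2 := by nlinarith
    _ = ∑ d ∈ Ioc 0 ⌊y⌋₊, (d : ℝ) := (sum_Ioc_cast _).symm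
    _ ≤ sigmaSum y := by
        refine Finset.sum_le_sum fun d hd => ?_
        rw [ArithmeticFunction.sigma_one_apply]
        have : d ∈ d.divisors := Nat.mem_divisors_self d (by have := (mem_Ioc.1 hd).1; omega)
        exact_mod_cast Finset.single_le_sum (f := fun i : ℕ => i) (fun _ _ => Nat.zero_le _) this

theorem tendsto_sigmaSum_div_sq :
    Tendsto (fun y : ℝ => sigmaSum y / y ^ 2) atTop (𝓝 sigmaConst) := by
  have key : Tendsto (fun y : ℝ => ∑' m : ℕ,
      ((⌊y / (m + 1)⌋₊ : ℝ) * ((⌊y / (m + 1)⌋₊ : ℝ) + 1) / 2) / y ^ 2) atTop (𝓝 sigmaConst) := by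
    refine tendsto_tsum_of_dominated_convergence (summable_sigmaConst.mul_left 2) (fun m => ?_) ?_
    · have hm : (0 : ℝ) < m + 1 := by positivity
      have h1 : Tendsto (fun y : ℝ => (⌊y / (m + 1)⌋₊ : ℝ) / (y / (m + 1))) atTop (𝓝 1) :=
        (tendsto_nat_floor_div_atTop (R := ℝ)).comp (tendsto_id.atTop_div_const hm)
      have h2 : Tendsto (fun y : ℝ => 1 / y) atTop (𝓝 0) := by
        simpa using tendsto_inv_atTop_zero (𝕜 := ℝ)
      have h3 := ((h1.div_const (m + 1)).mul ((h1.div_const (m + 1)).add h2)).div_const 2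
      have e : 1 / ((m : ℝ) + 1) * (1 / (m + 1) + 0) / 2 = 1 / (2 * ((m : ℝ) + 1) ^ 2) := by
        field_simp; ring
      rw [e] at h3
      refine h3.congr' ?_
      filter_upwards [eventually_gt_atTop 0] with y hy
      field_simp
    · filter_upwards [eventually_gt_atTop 0] with y hy m
      rw [Real.norm_of_nonneg (by positivity), div_le_iff₀ (by positivity)]
      linarith [floor_mul_succ_le hy.le m]
  refine key.congr fun y => ?_
  rw [tsum_div_const, ← sigmaSum_eq_tsum]

/-! ### Block bounds for the recurrence -/

/-- The part of the recurrence sum of `floor_mul_partitionReal` coming from `k ≤ y`. -/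
noncomputable def recurrenceSum (x y : ℝ) : ℝ :=
  ∑ k ∈ Ioc 0 ⌊y⌋₊, (ArithmeticFunction.sigma 1 k : ℝ) * partitionReal (x - k)

theorem recurrenceSum_zero (x : ℝ) : recurrenceSum x 0 = 0 := by simp [recurrenceSum]

theorem recurrenceSum_mono (x : ℝ) : Monotone (recurrenceSum x) := fun _ _ h =>
  Finset.sum_le_sum_of_subset_of_nonneg
    (Finset.Ioc_subset_Ioc_right (Nat.floor_le_floor h)) fun _ _ _ =>
      mul_nonneg (by positivity) (partitionReal_nonneg _)

theorem recurrenceSum_self {x : ℝ} (hx : 0 ≤ x) :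
    recurrenceSum x x = ⌊x⌋₊ * partitionReal x := (floor_mul_partitionReal hx).symm

theorem recurrenceSum_le {x : ℝ} (hx : 0 ≤ x) (y : ℝ) :
    recurrenceSum x y ≤ ⌊x⌋₊ * partitionReal x := by
  rw [← recurrenceSum_self hx]
  rcases le_total y x with h | h
  · exact recurrenceSum_mono x h
  · refine le_of_eq (Finset.sum_subset
      (Finset.Ioc_subset_Ioc_right (Nat.floor_le_floor h)) fun k _ hk => ?_).symm
    have : x < k := by
      rw [← Nat.floor_lt hx]
      simp only [mem_Ioc] at *
      omega
    rw [partitionReal_of_neg (by linarith), mul_zero]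

theorem recurrenceSum_sub (x : ℝ) {u v : ℝ} (huv : u ≤ v) :
    recurrenceSum x v - recurrenceSum x u
      = ∑ k ∈ Ioc ⌊u⌋₊ ⌊v⌋₊, (ArithmeticFunction.sigma 1 k : ℝ) * partitionReal (x - k) := by
  rw [recurrenceSum, recurrenceSum, ← Finset.sum_Ioc_consecutive _ (Nat.zero_le _)
    (Nat.floor_le_floor huv), add_sub_cancel_left]

theorem sigmaSum_sub {u v : ℝ} (huv : u ≤ v) :
    sigmaSum v - sigmaSum u
      = ∑ k ∈ Ioc ⌊u⌋₊ ⌊v⌋₊, (ArithmeticFunction.sigma 1 k : ℝ) := by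
  rw [sigmaSum, sigmaSum, ← Finset.sum_Ioc_consecutive _ (Nat.zero_le _)
    (Nat.floor_le_floor huv), add_sub_cancel_left]

theorem recurrenceSum_sub_le (x : ℝ) {u v : ℝ} (hu : 0 ≤ u) (huv : u ≤ v) :
    recurrenceSum x v - recurrenceSum x u
      ≤ (sigmaSum v - sigmaSum u) * partitionReal (x - u) := by
  rw [recurrenceSum_sub x huv, sigmaSum_sub huv, Finset.sum_mul]
  refine Finset.sum_le_sum fun k hk => ?_
  have hk' : u < k := (Nat.floor_lt hu).1 (mem_Ioc.1 hk).1
  gcongr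
  exact partitionReal_monotone (by linarith)

theorem le_recurrenceSum_sub (x : ℝ) {u v : ℝ} (hu : 0 ≤ u) (huv : u ≤ v) :
    (sigmaSum v - sigmaSum u) * partitionReal (x - v)
      ≤ recurrenceSum x v - recurrenceSum x u := by
  rw [recurrenceSum_sub x huv, sigmaSum_sub huv, Finset.sum_mul]
  refine Finset.sum_le_sum fun k hk => ?_
  have hk' : (k : ℝ) ≤ v := (Nat.le_floor_iff (hu.trans huv)).1 (mem_Ioc.1 hk).2
  gcongr
  exact partitionReal_monotone (by linarith)

theorem sum_range_sub_succ_mul (f : ℝ → ℝ) (h : ℝ) (J : ℕ) :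
    ∑ j ∈ range J, (f ((j + 1) * h) - f (j * h)) = f (J * h) - f 0 := by
  have := Finset.sum_range_sub (fun j : ℕ => f (j * h)) J
  simpa using this

theorem sigmaSum_block_nonneg {h : ℝ} (hh : 0 ≤ h) (j : ℕ) :
    0 ≤ sigmaSum ((j + 1) * h) - sigmaSum (j * h) :=
  sub_nonneg.2 (sigmaSum_monotone (by nlinarith))

/-- Upper bound for the recurrence sum, with `k` grouped into blocks `(j h, (j + 1) h]` and
`p(x - k)` replaced by its value at the start of the block. -/
theorem floor_mul_partitionReal_le_tsum {x h : ℝ} (hx : 0 ≤ x) (hh : 0 < h) :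
    ⌊x⌋₊ * partitionReal x ≤
      ∑' j : ℕ, (sigmaSum ((j + 1) * h) - sigmaSum (j * h)) * partitionReal (x - j * h) := by
  obtain ⟨J, hJ⟩ := exists_nat_gt (x / h)
  rw [div_lt_iff₀ hh] at hJ
  rw [tsum_eq_sum (s := range J)]
  · calc ⌊x⌋₊ * partitionReal x = recurrenceSum x x := (recurrenceSum_self hx).symm
      _ ≤ recurrenceSum x (J * h) - recurrenceSum x 0 := by
          rw [recurrenceSum_zero, sub_zero]
          exact recurrenceSum_mono x hJ.le
      _ = ∑ j ∈ range J, (recurrenceSum x ((j + 1) * h) - recurrenceSum x (j * h)) :=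
          (sum_range_sub_succ_mul _ _ _).symm
      _ ≤ _ := Finset.sum_le_sum fun j _ =>
          recurrenceSum_sub_le x (by positivity) (by nlinarith)
  · intro j hj
    have : (J : ℝ) ≤ j := by exact_mod_cast (by simpa using hj : J ≤ j)
    rw [partitionReal_of_neg (by nlinarith), mul_zero]

/-- Lower bound for the recurrence sum, with `p(x - k)` replaced by its value at the end of each
block. -/
theorem tsum_le_floor_mul_partitionReal {x h : ℝ} (hx : 0 ≤ x) (hh : 0 < h) :
    ∑' j : ℕ, (sigmaSum ((j + 1) * h) - sigmaSum (j * h)) * partitionReal (x - (j + 1) * h)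
      ≤ ⌊x⌋₊ * partitionReal x := by
  refine Real.tsum_le_of_sum_range_le
    (fun j => mul_nonneg (sigmaSum_block_nonneg hh.le j) (partitionReal_nonneg _)) fun J => ?_
  calc _ ≤ ∑ j ∈ range J, (recurrenceSum x ((j + 1) * h) - recurrenceSum x (j * h)) :=
        Finset.sum_le_sum fun j _ => le_recurrenceSum_sub x (by positivity) (by nlinarith)
    _ = recurrenceSum x (J * h) := by
        rw [sum_range_sub_succ_mul, recurrenceSum_zero, sub_zero]
    _ ≤ _ := recurrenceSum_le hx _

/-! ### Growth on the scale of the square root -/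

/-- The terms `k ≤ 4√x` of the recurrence contribute at least `6 x p(x - 4√x)`, and `6 ≥ e`. -/
theorem partitionReal_sub_four_sqrt_le {x : ℝ} (hx : 0 < x) :
    partitionReal (x - 4 * √x) ≤ Real.exp (-1) * partitionReal x := by
  have hs := Real.sq_sqrt hx.le
  have hs0 : 0 < √x := Real.sqrt_pos.2 hx
  rcases lt_or_ge (√x) 4 with h | h
  · rw [partitionReal_of_neg (by nlinarith)]
    exact mul_nonneg (Real.exp_pos _).le (partitionReal_nonneg _)
  · have h1 := le_recurrenceSum_sub x le_rfl (by positivity : 0 ≤ 4 * √x)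
    rw [sigmaSum_zero, recurrenceSum_zero, sub_zero, sub_zero] at h1
    have h2 := recurrenceSum_le hx.le (4 * √x)
    have h3 : ⌊x⌋₊ * partitionReal x ≤ x * partitionReal x :=
      mul_le_mul_of_nonneg_right (Nat.floor_le hx.le) (partitionReal_nonneg _)
    have h4 := le_sigmaSum (y := 4 * √x) (by linarith)
    have h5 : 6 * x ≤ sigmaSum (4 * √x) := by nlinarith
    have h6 : 6 * x * partitionReal (x - 4 * √x) ≤ x * partitionReal x :=
      (mul_le_mul_of_nonneg_right h5 (partitionReal_nonneg _)).trans (h1.trans (h2.trans h3))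
    have h7 : 6 * partitionReal (x - 4 * √x) ≤ partitionReal x := by
      refine le_of_mul_le_mul_left ?_ hx
      linarith
    have h8 : (1 : ℝ) / 6 ≤ Real.exp (-1) := by
      rw [Real.exp_neg, one_div]
      exact inv_anti₀ (Real.exp_pos _) (by linarith [Real.exp_one_lt_d9])
    nlinarith [partitionReal_nonneg x]

theorem partitionReal_sub_nat_mul_sqrt_le {x n : ℝ} (hx : 0 < x) (hxn : x ≤ n) (j : ℕ) :
    partitionReal (x - j * (4 * √n)) ≤ Real.exp (-j) * partitionReal x := by
  have hn : 0 < √n := Real.sqrt_pos.2 (hx.trans_le hxn)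
  induction j with
  | zero => simp
  | succ j ih =>
    set y := x - j * (4 * √n) with hy
    have hyn : y ≤ n := by
      have : 0 ≤ j * (4 * √n) := by positivity
      linarith
    have e : x - (j + 1 : ℕ) * (4 * √n) = y - 4 * √n := by rw [hy]; push_cast; ring
    rw [e]
    rcases le_or_gt y 0 with h | h
    · rw [partitionReal_of_neg (by linarith)]
      exact mul_nonneg (Real.exp_pos _).le (partitionReal_nonneg _)
    · calc partitionReal (y - 4 * √n) ≤ partitionReal (y - 4 * √y) :=
            partitionReal_monotone (by linarith [Real.sqrt_le_sqrt hyn])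
        _ ≤ Real.exp (-1) * partitionReal y := partitionReal_sub_four_sqrt_le h
        _ ≤ Real.exp (-1) * (Real.exp (-j) * partitionReal x) := by gcongr
        _ = Real.exp (-(j + 1 : ℕ)) * partitionReal x := by
            rw [← mul_assoc, ← Real.exp_add]
            push_cast
            ring_nf

/-- Exponential decay of `u ↦ p(x - u√n)`, uniformly in `x ≤ n`. -/
theorem partitionReal_sub_mul_sqrt_le {x n u : ℝ} (hx : 0 < x) (hxn : x ≤ n) (hu : 0 ≤ u) :
    partitionReal (x - u * √n) ≤ Real.exp (1 - u / 4) * partitionReal x := by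
  have hn : 0 < √n := Real.sqrt_pos.2 (hx.trans_le hxn)
  have h1 : (⌊u / 4⌋₊ : ℝ) ≤ u / 4 := Nat.floor_le (by positivity)
  have h2 : u / 4 - 1 < ⌊u / 4⌋₊ := Nat.sub_one_lt_floor _
  calc partitionReal (x - u * √n) ≤ partitionReal (x - ⌊u / 4⌋₊ * (4 * √n)) :=
        partitionReal_monotone (by nlinarith)
    _ ≤ Real.exp (-⌊u / 4⌋₊) * partitionReal x := partitionReal_sub_nat_mul_sqrt_le hx hxn _
    _ ≤ Real.exp (1 - u / 4) * partitionReal x :=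
        mul_le_mul_of_nonneg_right (Real.exp_le_exp.2 (by linarith)) (partitionReal_nonneg _)

theorem summable_sq_mul_exp {a : ℝ} (ha : 0 < a) :
    Summable fun j : ℕ => ((j : ℝ) + 1) ^ 2 * Real.exp (-(j * a)) := by
  have hr : ‖Real.exp (-a)‖ < 1 := by
    rw [Real.norm_of_nonneg (Real.exp_pos _).le, Real.exp_lt_one_iff]
    linarith
  have h0 : Summable fun j : ℕ => (j : ℝ) ^ 2 * Real.exp (-a) ^ j :=
    summable_pow_mul_geometric_of_norm_lt_one 2 hr
  have h : Summable fun j : ℕ => ((j + 1 : ℕ) : ℝ) ^ 2 * Real.exp (-a) ^ (j + 1) :=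
    (summable_nat_add_iff (f := fun j : ℕ => (j : ℝ) ^ 2 * Real.exp (-a) ^ j) 1).2 h0
  have e : ∀ j : ℕ, Real.exp a * (((j + 1 : ℕ) : ℝ) ^ 2 * Real.exp (-a) ^ (j + 1))
      = ((j : ℝ) + 1) ^ 2 * Real.exp (-(j * a)) := fun j => by
    have : Real.exp a * Real.exp (-a) ^ (j + 1) = Real.exp (-(j * a)) := by
      rw [← Real.exp_nat_mul, ← Real.exp_add]
      congr 1
      push_cast
      ring
    rw [mul_left_comm, this]
    push_cast
    rfl
  exact (h.mul_left (Real.exp a)).congr e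

/-- The growth over a window of length `ε√x` is bounded. In the recurrence for `x p(x)` the terms
`k ≤ ε√x` contribute at most `x p(x) / 4` once `ε` is small, and by exponential decay the remaining
terms contribute `O(x p(x - ε√x))`. -/
theorem exists_partitionReal_le_mul :
    ∃ ε K : ℝ, 0 < ε ∧ 0 < K ∧ ∀ x : ℝ, 2 ≤ x →
      partitionReal x ≤ K * partitionReal (x - ε * √x) := by
  have hc := sigmaConst_pos
  set ε : ℝ := 1 / (1 + 8 * sigmaConst) with hε
  have hε0 : 0 < ε := by positivity
  have hε1 : ε ≤ 1 := by rw [hε, div_le_one (by positivity)]; linarith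
  have hε2 : 8 * sigmaConst * ε ≤ 1 := by
    rw [hε, mul_one_div, div_le_one (by positivity)]; linarith
  have hε3 : 8 * sigmaConst * ε ^ 2 ≤ 1 := by nlinarith
  have hsum := summable_sq_mul_exp (a := ε / 4) (by positivity)
  set S := ∑' j : ℕ, ((j : ℝ) + 1) ^ 2 * Real.exp (-(j * (ε / 4))) with hS
  have hS0 : 0 < S := hsum.tsum_pos (fun j => by positivity) 0 (by simp)
  set A := Real.exp (1 + ε / 4) with hA
  refine ⟨ε, 4 * (2 * sigmaConst * ε ^ 2 * (A * S)), hε0, by positivity, fun x hx => ?_⟩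
  have hx0 : 0 < x := by linarith
  have hs0 : 0 < √x := Real.sqrt_pos.2 hx0
  have hs := Real.sq_sqrt hx0.le
  have hs1 : √x < x := by
    have : 1 < √x := by rw [Real.lt_sqrt (by norm_num)]; linarith
    nlinarith
  have hy : 0 < x - ε * √x := by nlinarith
  have hP0 := partitionReal_nonneg x
  have hQ0 := partitionReal_nonneg (x - ε * √x)
  have hup := floor_mul_partitionReal_le_tsum hx0.le (h := ε * √x) (by positivity)
  set B := 2 * sigmaConst * ε ^ 2 * x with hB
  have hB0 : 0 ≤ B := by positivity
  have hD : ∀ j : ℕ, sigmaSum ((j + 1) * (ε * √x)) ≤ B * ((j : ℝ) + 1) ^ 2 := fun j => by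
    refine (sigmaSum_le (by positivity)).trans (le_of_eq ?_)
    rw [hB, mul_pow, mul_pow, hs]
    ring
  have hDn : ∀ y, 0 ≤ sigmaSum y := fun y => Finset.sum_nonneg fun _ _ => by positivity
  -- the indicator of `j = 0` carries the first block, which involves `p(x)` itself
  have hterm : ∀ j : ℕ,
      (sigmaSum ((j + 1) * (ε * √x)) - sigmaSum (j * (ε * √x)))
        * partitionReal (x - j * (ε * √x))
      ≤ (if j = 0 then B * partitionReal x else 0)
        + B * A * partitionReal (x - ε * √x) * (((j : ℝ) + 1) ^ 2 * Real.exp (-(j * (ε / 4)))) := by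
    intro j
    have h1 : sigmaSum ((j + 1) * (ε * √x)) - sigmaSum (j * (ε * √x)) ≤ B * ((j : ℝ) + 1) ^ 2 :=
      by linarith [hD j, hDn (j * (ε * √x))]
    refine (mul_le_mul_of_nonneg_right h1 (partitionReal_nonneg _)).trans ?_
    rcases Nat.eq_zero_or_pos j with rfl | hj
    · simp only [if_true, Nat.cast_zero, zero_mul, sub_zero, zero_add, one_pow, mul_one]
      have : 0 ≤ B * A * partitionReal (x - ε * √x) * Real.exp (-0) := by positivity
      nlinarith
    · rw [if_neg hj.ne', zero_add]
      have hj1 : (1 : ℝ) ≤ j := by exact_mod_cast hj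
      have h2 := partitionReal_sub_mul_sqrt_le hy (by nlinarith : x - ε * √x ≤ x)
        (u := (j - 1) * ε) (by nlinarith)
      have e1 : x - ε * √x - (j - 1) * ε * √x = x - j * (ε * √x) := by ring
      have e2 : Real.exp (1 - (j - 1) * ε / 4) = A * Real.exp (-(j * (ε / 4))) := by
        rw [hA, ← Real.exp_add]; congr 1; ring
      rw [e1, e2] at h2
      calc B * ((j : ℝ) + 1) ^ 2 * partitionReal (x - j * (ε * √x))
          ≤ B * ((j : ℝ) + 1) ^ 2
            * (A * Real.exp (-(j * (ε / 4))) * partitionReal (x - ε * √x)) := by gcongr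
        _ = _ := by ring
  have hsum1 : Summable fun j : ℕ => if j = 0 then B * partitionReal x else 0 :=
    (hasSum_ite_eq 0 _).summable
  have hsum2 := hsum.mul_left (B * A * partitionReal (x - ε * √x))
  have hsum3 := hsum1.add hsum2
  have hub : ⌊x⌋₊ * partitionReal x
      ≤ B * partitionReal x + B * A * partitionReal (x - ε * √x) * S := by
    refine hup.trans ((Summable.tsum_le_tsum hterm (.of_nonneg_of_le (fun j => mul_nonneg
      (sigmaSum_block_nonneg (by positivity) j) (partitionReal_nonneg _)) hterm hsum3)
      hsum3).trans (le_of_eq ?_))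
    rw [hsum1.tsum_add hsum2, tsum_ite_eq, tsum_mul_left]
  have hfl : x / 2 ≤ ⌊x⌋₊ := by linarith [Nat.sub_one_lt_floor x]
  have hB4 : B ≤ x / 4 := by rw [hB]; nlinarith
  have h1 : x / 2 * partitionReal x ≤ ⌊x⌋₊ * partitionReal x := by gcongr
  have h2 : B * partitionReal x ≤ x / 4 * partitionReal x := by gcongr
  refine le_of_mul_le_mul_left ?_ hx0
  rw [hB] at *
  nlinarith

theorem exists_partitionReal_add_le (t : ℝ) :
    ∃ K : ℝ, 0 < K ∧ ∀ x : ℝ, 2 ≤ x → partitionReal (x + t * √x) ≤ K * partitionReal x := by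
  obtain ⟨ε, K, hε, hK, h⟩ := exists_partitionReal_le_mul
  have key : ∀ j : ℕ, ∀ x : ℝ, 2 ≤ x →
      partitionReal (x + j * (ε * √x)) ≤ K ^ j * partitionReal x := by
    intro j x hx
    induction j with
    | zero => simp
    | succ j ih =>
      set y := x + (j + 1 : ℕ) * (ε * √x) with hy
      have hxy : x ≤ y := by
        have : 0 ≤ ((j + 1 : ℕ) : ℝ) * (ε * √x) := by positivity
        linarith
      calc partitionReal y ≤ K * partitionReal (y - ε * √y) := h y (hx.trans hxy)
        _ ≤ K * partitionReal (x + j * (ε * √x)) := by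
            gcongr
            refine partitionReal_monotone ?_
            have : ε * √x ≤ ε * √y := by gcongr
            rw [hy] at this ⊢
            push_cast at this ⊢
            linarith
        _ ≤ K * (K ^ j * partitionReal x) := by gcongr
        _ = K ^ (j + 1) * partitionReal x := by ring
  obtain ⟨j, hj⟩ := exists_nat_ge (t / ε)
  rw [div_le_iff₀ hε] at hj
  refine ⟨K ^ j, by positivity, fun x hx => le_trans (partitionReal_monotone ?_) (key j x hx)⟩
  have := mul_le_mul_of_nonneg_right hj (Real.sqrt_nonneg x)
  linarith

/-- The ratio `p(x + t√x) / p(x)`. -/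
noncomputable def partitionRatio (x t : ℝ) : ℝ := partitionReal (x + t * √x) / partitionReal x

theorem partitionRatio_nonneg (x t : ℝ) : 0 ≤ partitionRatio x t :=
  div_nonneg (partitionReal_nonneg _) (partitionReal_nonneg _)

theorem partitionRatio_monotone (x : ℝ) : Monotone (partitionRatio x) := fun s t h =>
  div_le_div_of_nonneg_right (partitionReal_monotone (by
    have := mul_le_mul_of_nonneg_right h (Real.sqrt_nonneg x)
    linarith)) (partitionReal_nonneg _)

theorem partitionRatio_zero {x : ℝ} (hx : 0 ≤ x) : partitionRatio x 0 = 1 := by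
  rw [partitionRatio, zero_mul, add_zero, div_self (partitionReal_pos hx).ne']

/-- The exponential bound that dominates the block sums, uniformly in `x`. -/
theorem exists_partitionRatio_le (T : ℝ) :
    ∃ K : ℝ, 0 < K ∧ ∀ x : ℝ, 2 ≤ x → ∀ s ≤ T, partitionRatio x s ≤ K * Real.exp (s / 4) := by
  obtain ⟨K, hK, h⟩ := exists_partitionReal_add_le T
  refine ⟨Real.exp 1 + K, by positivity, fun x hx s hs => ?_⟩
  have hx0 : 0 < x := by linarith
  have hP := partitionReal_pos hx0.le
  have hE := Real.exp_pos (s / 4)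
  have hE1 := Real.exp_pos 1
  rcases le_total s 0 with h0 | h0
  · have h1 := partitionReal_sub_mul_sqrt_le hx0 le_rfl (neg_nonneg.2 h0)
    rw [neg_mul, sub_neg_eq_add, show 1 - -s / 4 = 1 + s / 4 by ring, Real.exp_add] at h1
    rw [partitionRatio, div_le_iff₀ hP]
    nlinarith [mul_pos (mul_pos hK hE) hP]
  · have h1 := (partitionRatio_monotone x hs).trans
      ((div_le_iff₀ hP).2 (h x hx) : partitionRatio x T ≤ K)
    have h2 : 1 ≤ Real.exp (s / 4) := Real.one_le_exp (by positivity)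
    nlinarith

/-! ### Passage to the limit in the recurrence -/

theorem tendsto_sigmaSum_mul_sqrt_div {a : ℝ} (ha : 0 ≤ a) :
    Tendsto (fun x : ℝ => sigmaSum (a * √x) / x) atTop (𝓝 (sigmaConst * a ^ 2)) := by
  rcases ha.eq_or_lt with rfl | ha
  · simp [sigmaSum_zero]
  · have h1 : Tendsto (fun x : ℝ => a * √x) atTop atTop :=
      Real.tendsto_sqrt_atTop.const_mul_atTop ha
    refine ((tendsto_sigmaSum_div_sq.comp h1).mul_const (a ^ 2)).congr' ?_
    filter_upwards [eventually_gt_atTop 0] with x hx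
    have hs := Real.sq_sqrt hx.le
    simp only [Function.comp_apply]
    rw [mul_pow, hs]
    field_simp

theorem tendsto_add_mul_sqrt_div (t : ℝ) :
    Tendsto (fun x : ℝ => (x + t * √x) / x) atTop (𝓝 1) := by
  have h : Tendsto (fun x : ℝ => 1 + t * (√x)⁻¹) atTop (𝓝 (1 + t * 0)) :=
    ((tendsto_inv_atTop_zero.comp Real.tendsto_sqrt_atTop).const_mul t).const_add 1
  rw [mul_zero, add_zero] at h
  refine h.congr' ?_
  filter_upwards [eventually_gt_atTop 0] with x hx
  have hs := Real.mul_self_sqrt hx.le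
  have hs0 : √x ≠ 0 := (Real.sqrt_pos.2 hx).ne'
  rw [add_div, div_self hx.ne']
  congr 1
  nth_rw 3 [← hs]
  field_simp

theorem tendsto_add_mul_sqrt_atTop (t : ℝ) :
    Tendsto (fun x : ℝ => x + t * √x) atTop atTop := by
  refine ((tendsto_add_mul_sqrt_div t).pos_mul_atTop one_pos tendsto_id).congr' ?_
  filter_upwards [eventually_gt_atTop 0] with x hx
  simp only [id]
  field_simp

theorem tendsto_floor_add_mul_sqrt_div (t : ℝ) :
    Tendsto (fun x : ℝ => (⌊x + t * √x⌋₊ : ℝ) / x) atTop (𝓝 1) := by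
  have h := ((tendsto_nat_floor_div_atTop (R := ℝ)).comp (tendsto_add_mul_sqrt_atTop t)).mul
    (tendsto_add_mul_sqrt_div t)
  rw [one_mul] at h
  refine h.congr' ?_
  filter_upwards [eventually_gt_atTop 0, (tendsto_add_mul_sqrt_atTop t).eventually_gt_atTop 0]
    with x hx hy
  simp only [Function.comp_apply]
  field_simp

theorem partitionReal_eq_ratio_mul {x : ℝ} (hx : 0 ≤ x) (t : ℝ) :
    partitionReal (x + t * √x) = partitionRatio x t * partitionReal x := by
  rw [partitionRatio, div_mul_cancel₀ _ (partitionReal_pos hx).ne']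

section Limit

variable {F : Filter ℝ} {g : ℝ → ℝ}

/-- Block sums of the recurrence, divided by `x p(x)`, converge termwise under a summable bound. -/
theorem tendsto_tsum_blocks (hF : F ≤ atTop) (hg : ∀ t, Tendsto (partitionRatio · t) F (𝓝 (g t)))
    {δ : ℝ} (hδ : 0 < δ) (t : ℝ) {s : ℕ → ℝ} (hs : ∀ j : ℕ, s j ≤ t - j * δ) :
    Tendsto (fun x : ℝ => ∑' j : ℕ,
      (sigmaSum ((j + 1) * (δ * √x)) - sigmaSum (j * (δ * √x))) / x * partitionRatio x (s j)) F
      (𝓝 (∑' j : ℕ, sigmaConst * δ ^ 2 * (2 * j + 1) * g (s j))) := by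
  obtain ⟨K, hK, hle⟩ := exists_partitionRatio_le t
  refine tendsto_tsum_of_dominated_convergence
    ((summable_sq_mul_exp (a := δ / 4) (by positivity)).mul_left
      (2 * sigmaConst * δ ^ 2 * (K * Real.exp (t / 4)))) (fun j => ?_) ?_
  · refine Tendsto.mul (Tendsto.mono_left ?_ hF) (hg _)
    have h1 := tendsto_sigmaSum_mul_sqrt_div (a := (j + 1) * δ) (by positivity)
    have h2 := tendsto_sigmaSum_mul_sqrt_div (a := j * δ) (by positivity)
    have h3 := h1.sub h2
    have e : sigmaConst * ((j + 1) * δ) ^ 2 - sigmaConst * (j * δ) ^ 2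
        = sigmaConst * δ ^ 2 * (2 * j + 1) := by ring
    rw [e] at h3
    refine h3.congr fun x => ?_
    rw [← sub_div, mul_assoc, mul_assoc]
  · filter_upwards [hF (eventually_ge_atTop 2)] with x hx j
    have hx0 : 0 < x := by linarith
    have hc := sigmaConst_pos
    have hb := sigmaSum_block_nonneg (h := δ * √x) (by positivity) j
    have hr := partitionRatio_nonneg x (s j)
    rw [Real.norm_of_nonneg (mul_nonneg (div_nonneg hb hx0.le) hr)]
    have hst : s j ≤ t := (hs j).trans (by have : 0 ≤ j * δ := by positivity
                                           linarith)
    have h1 : (sigmaSum ((j + 1) * (δ * √x)) - sigmaSum (j * (δ * √x))) / x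
        ≤ 2 * sigmaConst * δ ^ 2 * ((j : ℝ) + 1) ^ 2 := by
      rw [div_le_iff₀ hx0]
      have h2 := sigmaSum_le (y := (j + 1) * (δ * √x)) (by positivity)
      have h3 : 0 ≤ sigmaSum (j * (δ * √x)) := Finset.sum_nonneg fun _ _ => by positivity
      rw [mul_pow, mul_pow, Real.sq_sqrt hx0.le] at h2
      linarith
    have h2 : partitionRatio x (s j) ≤ K * Real.exp (t / 4) * Real.exp (-(j * (δ / 4))) := by
      refine (hle x hx _ hst).trans ?_
      rw [mul_assoc, ← Real.exp_add]
      gcongr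
      linarith [hs j]
    calc _ ≤ 2 * sigmaConst * δ ^ 2 * ((j : ℝ) + 1) ^ 2
          * (K * Real.exp (t / 4) * Real.exp (-(j * (δ / 4)))) := by gcongr
      _ = _ := by ring

theorem limit_le_tsum [F.NeBot] (hF : F ≤ atTop)
    (hg : ∀ t, Tendsto (partitionRatio · t) F (𝓝 (g t))) {δ : ℝ} (hδ : 0 < δ) (t : ℝ) :
    g t ≤ ∑' j : ℕ, sigmaConst * δ ^ 2 * (2 * j + 1) * g (t - j * δ) := by
  have h1 := ((tendsto_floor_add_mul_sqrt_div t).mono_left hF).mul (hg t)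
  rw [one_mul] at h1
  refine le_of_tendsto_of_tendsto h1 (tendsto_tsum_blocks hF hg hδ t fun j => le_rfl) ?_
  filter_upwards [hF (eventually_gt_atTop 0),
    hF ((tendsto_add_mul_sqrt_atTop t).eventually_ge_atTop 0)] with x hx hy
  have hP := partitionReal_pos hx.le
  have h := floor_mul_partitionReal_le_tsum hy (h := δ * √x)
    (mul_pos hδ (Real.sqrt_pos.2 hx))
  have e : ∀ j : ℕ, (sigmaSum ((j + 1) * (δ * √x)) - sigmaSum (j * (δ * √x)))
        * partitionReal (x + t * √x - j * (δ * √x))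
      = (x * partitionReal x) * ((sigmaSum ((j + 1) * (δ * √x)) - sigmaSum (j * (δ * √x))) / x
        * partitionRatio x (t - j * δ)) := fun j => by
    rw [show x + t * √x - j * (δ * √x) = x + (t - j * δ) * √x by ring,
      partitionReal_eq_ratio_mul hx.le]
    field_simp
  rw [tsum_congr e, tsum_mul_left, partitionReal_eq_ratio_mul hx.le] at h
  refine le_of_mul_le_mul_left ?_ (mul_pos hx hP)
  refine le_trans (le_of_eq ?_) h
  field_simp

theorem tsum_le_limit [F.NeBot] (hF : F ≤ atTop)
    (hg : ∀ t, Tendsto (partitionRatio · t) F (𝓝 (g t))) {δ : ℝ} (hδ : 0 < δ) (t : ℝ) :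
    ∑' j : ℕ, sigmaConst * δ ^ 2 * (2 * j + 1) * g (t - (j + 1) * δ) ≤ g t := by
  have h1 := ((tendsto_floor_add_mul_sqrt_div t).mono_left hF).mul (hg t)
  rw [one_mul] at h1
  refine le_of_tendsto_of_tendsto (tendsto_tsum_blocks hF hg hδ t fun j => by linarith) h1 ?_
  filter_upwards [hF (eventually_gt_atTop 0),
    hF ((tendsto_add_mul_sqrt_atTop t).eventually_ge_atTop 0)] with x hx hy
  have hP := partitionReal_pos hx.le
  have h := tsum_le_floor_mul_partitionReal hy (h := δ * √x)
    (mul_pos hδ (Real.sqrt_pos.2 hx))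
  have e : ∀ j : ℕ, (sigmaSum ((j + 1) * (δ * √x)) - sigmaSum (j * (δ * √x)))
        * partitionReal (x + t * √x - (j + 1) * (δ * √x))
      = (x * partitionReal x) * ((sigmaSum ((j + 1) * (δ * √x)) - sigmaSum (j * (δ * √x))) / x
        * partitionRatio x (t - (j + 1) * δ)) := fun j => by
    rw [show x + t * √x - (j + 1) * (δ * √x) = x + (t - (j + 1) * δ) * √x by ring,
      partitionReal_eq_ratio_mul hx.le]
    field_simp
  rw [tsum_congr e, tsum_mul_left, partitionReal_eq_ratio_mul hx.le] at h
  refine le_of_mul_le_mul_left ?_ (mul_pos hx hP)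
  refine h.trans (le_of_eq ?_)
  field_simp

theorem limit_monotone [F.NeBot] (hg : ∀ t, Tendsto (partitionRatio · t) F (𝓝 (g t))) :
    Monotone g := fun s t h =>
  le_of_tendsto_of_tendsto' (hg s) (hg t) fun x => partitionRatio_monotone x h

theorem limit_nonneg [F.NeBot] (hg : ∀ t, Tendsto (partitionRatio · t) F (𝓝 (g t))) (t : ℝ) :
    0 ≤ g t := ge_of_tendsto' (hg t) fun x => partitionRatio_nonneg x t

theorem limit_zero [F.NeBot] (hF : F ≤ atTop)
    (hg : ∀ t, Tendsto (partitionRatio · t) F (𝓝 (g t))) : g 0 = 1 :=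
  tendsto_nhds_unique_of_eventuallyEq (hg 0) tendsto_const_nhds (by
    filter_upwards [hF (eventually_ge_atTop 0)] with x hx using partitionRatio_zero hx)

theorem exists_limit_le [F.NeBot] (hF : F ≤ atTop)
    (hg : ∀ t, Tendsto (partitionRatio · t) F (𝓝 (g t))) (T : ℝ) :
    ∃ K : ℝ, 0 < K ∧ ∀ s ≤ T, g s ≤ K * Real.exp (s / 4) := by
  obtain ⟨K, hK, h⟩ := exists_partitionRatio_le T
  exact ⟨K, hK, fun s hs => le_of_tendsto (hg s) (by
    filter_upwards [hF (eventually_ge_atTop 2)] with x hx using h x hx s hs)⟩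

end Limit

/-! ### The renewal equation -/

open MeasureTheory

section Primitive

variable {q : ℝ → ℝ}

theorem integral_Iic_eq_add (hq : ∀ t, IntegrableOn q (Set.Iic t)) (t : ℝ) :
    ∫ v in Set.Iic t, q v = (∫ v in Set.Iic 0, q v) + ∫ v in (0 : ℝ)..t, q v := by
  rw [← intervalIntegral.integral_Iic_sub_Iic (hq 0) (hq t)]
  ring

theorem intervalIntegrable_of_Iic (hq : ∀ t, IntegrableOn q (Set.Iic t)) (a b : ℝ) :
    IntervalIntegrable q volume a b :=
  ⟨(hq b).mono_set Set.Ioc_subset_Iic_self, (hq a).mono_set Set.Ioc_subset_Iic_self⟩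

theorem continuous_integral_Iic (hq : ∀ t, IntegrableOn q (Set.Iic t)) :
    Continuous fun t => ∫ v in Set.Iic t, q v := by
  rw [funext (integral_Iic_eq_add hq)]
  exact (intervalIntegral.continuous_primitive (intervalIntegrable_of_Iic hq) 0).const_add _

theorem hasDerivAt_integral_Iic (hq : ∀ t, IntegrableOn q (Set.Iic t)) (hc : Continuous q)
    (t : ℝ) : HasDerivAt (fun t => ∫ v in Set.Iic t, q v) (q t) t := by
  rw [funext (integral_Iic_eq_add hq)]
  exact ((hc.integral_hasStrictDerivAt 0 t).hasDerivAt).const_add _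

end Primitive

section Renewal

variable {g : ℝ → ℝ}

theorem integrableOn_Iic_of_exp_bound (hm : Monotone g) (h0 : ∀ t, 0 ≤ g t)
    (hb : ∀ T, ∃ K : ℝ, 0 < K ∧ ∀ s ≤ T, g s ≤ K * Real.exp (s / 4)) (t : ℝ) :
    IntegrableOn g (Set.Iic t) := by
  obtain ⟨K, _, h⟩ := hb t
  refine ((integrableOn_exp_mul_Iic (a := 1 / 4) (by norm_num) t).const_mul K).mono'
    hm.measurable.aestronglyMeasurable ?_
  filter_upwards [ae_restrict_mem measurableSet_Iic] with s hs
  rw [Real.norm_of_nonneg (h0 s)]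
  refine (h s hs).trans (le_of_eq ?_)
  congr 2
  ring

theorem integrableOn_sub_mul_of_exp_bound (hm : Monotone g) (h0 : ∀ t, 0 ≤ g t)
    (hb : ∀ T, ∃ K : ℝ, 0 < K ∧ ∀ s ≤ T, g s ≤ K * Real.exp (s / 4)) (t : ℝ) :
    IntegrableOn (fun v => (t - v) * g v) (Set.Iic t) := by
  obtain ⟨K, hK, h⟩ := hb t
  refine ((integrableOn_exp_mul_Iic (a := 1 / 8) (by norm_num) t).const_mul
    (8 * Real.exp (t / 8) * K)).mono'
    ((measurable_const.sub measurable_id).mul hm.measurable).aestronglyMeasurable ?_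
  filter_upwards [ae_restrict_mem measurableSet_Iic] with s hs
  have hs' : 0 ≤ t - s := sub_nonneg.2 hs
  rw [Real.norm_of_nonneg (mul_nonneg hs' (h0 s))]
  have h1 : t - s ≤ 8 * Real.exp ((t - s) / 8) := by
    linarith [Real.add_one_le_exp ((t - s) / 8)]
  calc (t - s) * g s ≤ 8 * Real.exp ((t - s) / 8) * (K * Real.exp (s / 4)) :=
        mul_le_mul h1 (h s hs) (h0 s) (by positivity)
    _ = 8 * K * (Real.exp ((t - s) / 8) * Real.exp (s / 4)) := by ring
    _ = 8 * K * (Real.exp (t / 8) * Real.exp (1 / 8 * s)) := by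
        rw [← Real.exp_add, ← Real.exp_add]; congr 2; ring
    _ = _ := by ring

theorem integrableOn_id_mul_of_exp_bound (hm : Monotone g) (h0 : ∀ t, 0 ≤ g t)
    (hb : ∀ T, ∃ K : ℝ, 0 < K ∧ ∀ s ≤ T, g s ≤ K * Real.exp (s / 4)) (t : ℝ) :
    IntegrableOn (fun v => v * g v) (Set.Iic t) := by
  refine (((integrableOn_Iic_of_exp_bound hm h0 hb t).const_mul t).sub
    (integrableOn_sub_mul_of_exp_bound hm h0 hb t)).congr (.of_forall fun v => ?_)
  simp only [Pi.sub_apply]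
  ring

/-- The integral `∫_{v ≤ t} 2c (t - v) g(v) dv` on the right-hand side of the renewal equation. -/
noncomputable def renewalIntegral (c : ℝ) (g : ℝ → ℝ) (t : ℝ) : ℝ :=
  ∫ v in Set.Iic t, 2 * c * ((t - v) * g v)

theorem integral_block (c t δ : ℝ) (j : ℕ) (G : ℝ) :
    ∫ v in (t - (j + 1) * δ)..(t - j * δ), 2 * c * ((t - v) * G) = c * δ ^ 2 * (2 * j + 1) * G := by
  have e : ∀ v, 2 * c * ((t - v) * G) = 2 * c * G * (t - v) := fun v => by ring
  simp_rw [e]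
  rw [intervalIntegral.integral_const_mul, intervalIntegral.integral_sub (by simp)
    (by simp), intervalIntegral.integral_const, integral_id, smul_eq_mul]
  ring

theorem sum_integral_blocks {q : ℝ → ℝ} (hq : ∀ a b, IntervalIntegrable q volume a b)
    (t δ : ℝ) (J : ℕ) :
    ∑ j ∈ range J, ∫ v in (t - (j + 1) * δ)..(t - j * δ), q v = ∫ v in (t - J * δ)..t, q v := by
  induction J with
  | zero => simp
  | succ J ih =>
    rw [Finset.sum_range_succ, ih, add_comm]
    push_cast
    exact intervalIntegral.integral_add_adjacent_intervals (hq _ _) (hq _ _)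

theorem tendsto_integral_blocks {q : ℝ → ℝ} {t : ℝ} (hq : IntegrableOn q (Set.Iic t))
    {δ : ℝ} (hδ : 0 < δ) :
    Tendsto (fun J : ℕ => ∫ v in (t - J * δ)..t, q v) atTop (𝓝 (∫ v in Set.Iic t, q v)) := by
  refine intervalIntegral_tendsto_integral_Iic t hq ?_
  have : Tendsto (fun J : ℕ => (J : ℝ) * δ) atTop atTop :=
    tendsto_natCast_atTop_atTop.atTop_mul_const hδ
  exact tendsto_atBot_add_const_left _ t (tendsto_neg_atTop_atBot.comp this)

theorem intervalIntegrable_kernel (hm : Monotone g) (h0 : ∀ t, 0 ≤ g t)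
    (hb : ∀ T, ∃ K : ℝ, 0 < K ∧ ∀ s ≤ T, g s ≤ K * Real.exp (s / 4)) (c t a b : ℝ) :
    IntervalIntegrable (fun v => 2 * c * ((t - v) * g v)) volume a b := by
  have h1 := intervalIntegrable_of_Iic (integrableOn_Iic_of_exp_bound hm h0 hb) a b
  have h2 := intervalIntegrable_of_Iic (integrableOn_id_mul_of_exp_bound hm h0 hb) a b
  refine (((h1.const_mul t).sub h2).const_mul (2 * c)).congr fun v _ => ?_
  ring

theorem tsum_le_renewalIntegral (hm : Monotone g) (h0 : ∀ t, 0 ≤ g t)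
    (hb : ∀ T, ∃ K : ℝ, 0 < K ∧ ∀ s ≤ T, g s ≤ K * Real.exp (s / 4)) {c : ℝ} (hc : 0 < c)
    {δ : ℝ} (hδ : 0 < δ) (t : ℝ) :
    ∑' j : ℕ, c * δ ^ 2 * (2 * j + 1) * g (t - (j + 1) * δ) ≤ renewalIntegral c g t := by
  have hI := (integrableOn_sub_mul_of_exp_bound hm h0 hb t).const_mul (2 * c)
  have hker := intervalIntegrable_kernel hm h0 hb c t
  refine Real.tsum_le_of_sum_range_le
    (fun j => mul_nonneg (by positivity) (h0 _)) fun J => ?_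
  calc _ ≤ ∑ j ∈ range J, ∫ v in (t - (j + 1) * δ)..(t - j * δ), 2 * c * ((t - v) * g v) := by
        refine Finset.sum_le_sum fun j _ => ?_
        rw [← integral_block]
        have hj : (0 : ℝ) ≤ j * δ := by positivity
        refine intervalIntegral.integral_mono_on (by linarith)
          (Continuous.intervalIntegrable (by fun_prop) _ _) (hker _ _) fun v hv => ?_
        have h1 : 0 ≤ t - v := by linarith [hv.2]
        have h2 := hm hv.1
        gcongr
    _ = ∫ v in (t - J * δ)..t, 2 * c * ((t - v) * g v) := sum_integral_blocks hker t δ J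
    _ ≤ renewalIntegral c g t := by
        have hJ : (0 : ℝ) ≤ J * δ := by positivity
        rw [intervalIntegral.integral_of_le (by linarith), renewalIntegral]
        refine setIntegral_mono_set hI ?_ (Set.Ioc_subset_Iic_self.eventuallyLE)
        filter_upwards [ae_restrict_mem measurableSet_Iic] with v hv
        exact mul_nonneg (by positivity) (mul_nonneg (sub_nonneg.2 hv) (h0 v))

theorem renewalIntegral_le_tsum (hm : Monotone g) (h0 : ∀ t, 0 ≤ g t)
    (hb : ∀ T, ∃ K : ℝ, 0 < K ∧ ∀ s ≤ T, g s ≤ K * Real.exp (s / 4)) {c : ℝ} (hc : 0 < c)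
    {δ : ℝ} (hδ : 0 < δ) (t : ℝ) :
    renewalIntegral c g t ≤ ∑' j : ℕ, c * δ ^ 2 * (2 * j + 1) * g (t - j * δ) := by
  have hI := (integrableOn_sub_mul_of_exp_bound hm h0 hb t).const_mul (2 * c)
  have hker := intervalIntegrable_kernel hm h0 hb c t
  have hpos : ∀ j : ℕ, 0 ≤ c * δ ^ 2 * (2 * j + 1) * g (t - j * δ) := fun j =>
    mul_nonneg (by positivity) (h0 _)
  have hs : Summable fun j : ℕ => c * δ ^ 2 * (2 * j + 1) * g (t - j * δ) := by
    obtain ⟨K, hK, h⟩ := hb t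
    refine .of_nonneg_of_le hpos (fun j => ?_)
      ((summable_sq_mul_exp (a := δ / 4) (by positivity)).mul_left
        (2 * c * δ ^ 2 * (K * Real.exp (t / 4))))
    have hj : (0 : ℝ) ≤ j * δ := by positivity
    have h1 := h (t - j * δ) (by linarith)
    rw [show (t - j * δ) / 4 = t / 4 + -(j * (δ / 4)) by ring, Real.exp_add] at h1
    have h2 : (2 * j + 1 : ℝ) ≤ 2 * ((j : ℝ) + 1) ^ 2 := by
      nlinarith [(Nat.cast_nonneg j : (0 : ℝ) ≤ j)]
    calc _ ≤ c * δ ^ 2 * (2 * ((j : ℝ) + 1) ^ 2)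
          * (K * (Real.exp (t / 4) * Real.exp (-(j * (δ / 4))))) :=
          mul_le_mul (by gcongr) h1 (h0 _) (by positivity)
      _ = _ := by ring
  refine le_of_tendsto' (tendsto_integral_blocks hI hδ) fun J => ?_
  rw [← sum_integral_blocks hker t δ J]
  refine le_trans (Finset.sum_le_sum fun j _ => ?_) (hs.sum_le_tsum (range J) fun j _ => hpos j)
  rw [← integral_block]
  have hj : (0 : ℝ) ≤ j * δ := by positivity
  refine intervalIntegral.integral_mono_on (by linarith) (hker _ _)
    (Continuous.intervalIntegrable (by fun_prop) _ _) fun v hv => ?_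
  have h1 : 0 ≤ t - v := by linarith [hv.2]
  have h2 := hm hv.2
  gcongr

theorem renewalIntegral_eq (hm : Monotone g) (h0 : ∀ t, 0 ≤ g t)
    (hb : ∀ T, ∃ K : ℝ, 0 < K ∧ ∀ s ≤ T, g s ≤ K * Real.exp (s / 4)) (c t : ℝ) :
    renewalIntegral c g t
      = 2 * c * (t * (∫ v in Set.Iic t, g v) - ∫ v in Set.Iic t, v * g v) := by
  rw [renewalIntegral, integral_const_mul, ← integral_const_mul t,
    ← integral_sub ((integrableOn_Iic_of_exp_bound hm h0 hb t).const_mul t)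
      (integrableOn_id_mul_of_exp_bound hm h0 hb t)]
  simp_rw [sub_mul]

/-- A monotone function with exponential decay at `-∞` that lies between its lower and upper block
sums for every mesh `δ` is an exponential. -/
theorem eq_exp_of_renewal (hm : Monotone g) (h0 : ∀ t, 0 ≤ g t) (h1 : g 0 = 1)
    (hb : ∀ T, ∃ K : ℝ, 0 < K ∧ ∀ s ≤ T, g s ≤ K * Real.exp (s / 4)) {c : ℝ} (hc : 0 < c)
    (hup : ∀ δ : ℝ, 0 < δ → ∀ t, g t ≤ ∑' j : ℕ, c * δ ^ 2 * (2 * j + 1) * g (t - j * δ))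
    (hlo : ∀ δ : ℝ, 0 < δ → ∀ t,
      ∑' j : ℕ, c * δ ^ 2 * (2 * j + 1) * g (t - (j + 1) * δ) ≤ g t) (t : ℝ) :
    g t = Real.exp (√(2 * c) * t) := by
  have hgi := integrableOn_Iic_of_exp_bound hm h0 hb
  have hvi := integrableOn_id_mul_of_exp_bound hm h0 hb
  have hIeq : renewalIntegral c g
      = fun t => 2 * c * (t * (∫ v in Set.Iic t, g v) - ∫ v in Set.Iic t, v * g v) :=
    funext (renewalIntegral_eq hm h0 hb c)
  have hIc : Continuous (renewalIntegral c g) := by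
    rw [hIeq]
    exact ((continuous_id.mul (continuous_integral_Iic hgi)).sub
      (continuous_integral_Iic hvi)).const_mul _
  have hg : ∀ t, g t = renewalIntegral c g t := by
    intro t
    -- the lower sum at `u + δ` is the upper sum at `u`, so `g t` lies between the values of the
    -- integral at `t - δ` and `t + δ`
    have hshift : ∀ δ u : ℝ, ∑' j : ℕ, c * δ ^ 2 * (2 * j + 1) * g (u + δ - (j + 1) * δ)
        = ∑' j : ℕ, c * δ ^ 2 * (2 * j + 1) * g (u - j * δ) := fun δ u => by
      refine tsum_congr fun j => ?_
      congr 2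
      ring
    have hright : Tendsto (fun δ : ℝ => renewalIntegral c g (t + δ)) (𝓝[>] 0)
        (𝓝 (renewalIntegral c g t)) := by
      have : Continuous fun δ : ℝ => renewalIntegral c g (t + δ) := by fun_prop
      simpa using (this.tendsto 0).mono_left nhdsWithin_le_nhds
    have hleft : Tendsto (fun δ : ℝ => renewalIntegral c g (t - δ)) (𝓝[>] 0)
        (𝓝 (renewalIntegral c g t)) := by
      have : Continuous fun δ : ℝ => renewalIntegral c g (t - δ) := by fun_prop
      simpa using (this.tendsto 0).mono_left nhdsWithin_le_nhds
    refine le_antisymm (ge_of_tendsto hright ?_) (le_of_tendsto hleft ?_)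
    · filter_upwards [self_mem_nhdsWithin] with δ hδ
      refine (hup δ hδ t).trans ?_
      rw [← hshift]
      exact tsum_le_renewalIntegral hm h0 hb hc hδ _
    · filter_upwards [self_mem_nhdsWithin] with δ hδ
      refine (renewalIntegral_le_tsum hm h0 hb hc hδ (t - δ)).trans ?_
      rw [← hshift, sub_add_cancel]
      exact hlo δ hδ t
  have hgc : Continuous g := by rwa [funext hg]
  set H : ℝ → ℝ := fun t => ∫ v in Set.Iic t, g v with hH
  have hHd : ∀ t, HasDerivAt H (g t) t := hasDerivAt_integral_Iic hgi hgc
  have hgd : ∀ t, HasDerivAt g (2 * c * H t) t := by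
    intro t
    have h := (((hasDerivAt_id t).mul (hHd t)).sub
      (hasDerivAt_integral_Iic hvi (continuous_id.mul hgc) t)).const_mul (2 * c)
    rw [show g = _ from (funext hg).trans hIeq]
    refine h.congr_deriv ?_
    simp only [id]
    ring
  set C := √(2 * c) with hC
  have hC0 : 0 < C := Real.sqrt_pos.2 (by positivity)
  have hC2 : C * C = 2 * c := Real.mul_self_sqrt (by positivity)
  have hEd : ∀ a t : ℝ, HasDerivAt (fun t => Real.exp (a * t)) (Real.exp (a * t) * a) t :=
    fun a t => by simpa using ((hasDerivAt_id t).const_mul a).exp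
  -- the component `g - C H` solves `y' = -C y`
  have hwd : ∀ t, HasDerivAt (fun t => (g t - C * H t) * Real.exp (C * t)) 0 t := fun t => by
    refine (((hgd t).sub ((hHd t).const_mul C)).mul (hEd C t)).congr_deriv ?_
    simp only [Pi.sub_apply]
    rw [← hC2]
    ring
  have hwc : ∀ s, (g s - C * H s) * Real.exp (C * s) = (g 0 - C * H 0) * Real.exp (C * 0) :=
    fun s => is_const_of_deriv_eq_zero (fun t => (hwd t).differentiableAt)
      (fun t => (hwd t).deriv) s 0
  have hexp0 : ∀ a : ℝ, 0 < a → Tendsto (fun s : ℝ => Real.exp (a * s)) atBot (𝓝 0) := fun a ha =>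
    Real.tendsto_exp_atBot.comp (tendsto_id.const_mul_atBot ha)
  have hg0 : Tendsto g atBot (𝓝 0) := by
    obtain ⟨K, hK, h⟩ := hb 0
    refine squeeze_zero' (.of_forall h0) ?_
      (by simpa using (hexp0 (1 / 4) (by norm_num)).const_mul K)
    filter_upwards [eventually_le_atBot 0] with s hs
    refine (h s hs).trans (le_of_eq ?_)
    congr 2
    ring
  have hH0 : Tendsto H atBot (𝓝 0) := by
    obtain ⟨K, hK, h⟩ := hb 0
    refine squeeze_zero' (.of_forall fun s => integral_nonneg h0) ?_
      (by simpa using (hexp0 (1 / 4) (by norm_num)).const_mul (K * 4))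
    filter_upwards [eventually_le_atBot 0] with s hs
    have h2 : H s ≤ ∫ v in Set.Iic s, K * Real.exp (1 / 4 * v) := by
      refine setIntegral_mono_on (hgi s)
        ((integrableOn_exp_mul_Iic (a := 1 / 4) (by norm_num) s).const_mul K) measurableSet_Iic
        fun v hv => (h v (le_trans hv hs)).trans (le_of_eq ?_)
      congr 2
      ring
    rw [integral_const_mul, integral_exp_mul_Iic (by norm_num)] at h2
    linarith
  have hw0 : (g 0 - C * H 0) * Real.exp (C * 0) = 0 := by
    have h2 := (hg0.sub (hH0.const_mul C)).mul (hexp0 C hC0)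
    simp only [mul_zero, sub_zero] at h2
    exact tendsto_nhds_unique (tendsto_const_nhds.congr fun s => (hwc s).symm) h2
  have hgH : ∀ s, g s = C * H s := fun s => by
    have h2 := (hwc s).trans hw0
    have h3 := (mul_eq_zero.1 h2).resolve_right (Real.exp_pos _).ne'
    linarith
  -- hence `g' = C g`
  have hzd : ∀ t, HasDerivAt (fun t => g t * Real.exp (-C * t)) 0 t := fun t => by
    refine ((hgd t).mul (hEd (-C) t)).congr_deriv ?_
    rw [hgH t, ← hC2]
    ring
  have hz : g t * Real.exp (-C * t) = g 0 * Real.exp (-C * 0) :=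
    is_const_of_deriv_eq_zero (fun t => (hzd t).differentiableAt) (fun t => (hzd t).deriv) t 0
  rw [h1, mul_zero, Real.exp_zero, mul_one, neg_mul, Real.exp_neg] at hz
  have := (Real.exp_pos (C * t)).ne'
  field_simp at hz
  exact hz

end Renewal

/-- The constant `C = √(2c)` in the growth law `p(n + t√n) / p(n) → exp (C t)`. -/
noncomputable def growthRate : ℝ := √(2 * sigmaConst)

theorem growthRate_pos : 0 < growthRate :=
  Real.sqrt_pos.2 (mul_pos two_pos sigmaConst_pos)

/-- The growth law on the scale `√x`: along every ultrafilter the ratios have limits by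
compactness, and the renewal equation identifies them. -/
theorem tendsto_partitionRatio (t : ℝ) :
    Tendsto (partitionRatio · t) atTop (𝓝 (Real.exp (growthRate * t))) := by
  rw [tendsto_iff_ultrafilter]
  intro F hF
  have hex : ∀ s, ∃ y, Tendsto (partitionRatio · s) F (𝓝 y) := fun s => by
    obtain ⟨K, hK, h⟩ := exists_partitionRatio_le s
    have hmem : ∀ᶠ x in (F : Filter ℝ), partitionRatio x s ∈ Set.Icc 0 (K * Real.exp (s / 4)) := by
      filter_upwards [hF (eventually_ge_atTop 2)] with x hx
      exact ⟨partitionRatio_nonneg x s, h x hx s le_rfl⟩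
    obtain ⟨y, _, hy⟩ := isCompact_Icc.ultrafilter_le_nhds (F.map (partitionRatio · s))
      (le_principal_iff.2 hmem)
    exact ⟨y, hy⟩
  choose g hg using hex
  rw [growthRate, ← eq_exp_of_renewal (limit_monotone hg) (limit_nonneg hg) (limit_zero hF hg)
    (exists_limit_le hF hg) sigmaConst_pos (fun δ hδ => limit_le_tsum hF hg hδ)
    (fun δ hδ => tsum_le_limit hF hg hδ) t]
  exact hg t

/-! ### Spacing of the level sets -/

/-- A finite limit of `p` would force the ratios to tend to `1`. -/
theorem tendsto_partitionReal_atTop : Tendsto partitionReal atTop atTop := by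
  rcases tendsto_atTop_of_monotone partitionReal_monotone with h | ⟨l, hl⟩
  · exact h
  · exfalso
    have h0 := partitionReal_pos le_rfl
    have hl0 : 0 < l := h0.trans_le (ge_of_tendsto hl (by
      filter_upwards [eventually_ge_atTop 0] with x hx using partitionReal_monotone hx))
    have h1 := (hl.comp (tendsto_add_mul_sqrt_atTop 1)).div hl hl0.ne'
    rw [div_self hl0.ne'] at h1
    have h2 := tendsto_nhds_unique h1 (tendsto_partitionRatio 1)
    have h3 := Real.add_one_le_exp (growthRate * 1)
    have h4 := growthRate_pos
    linarith

/-- The number of `n` with `p(n) < y`, equivalently the first `n` with `p(n) ≥ y`. -/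
noncomputable def firstIndex (y : ℝ) : ℕ := sInf {n : ℕ | y ≤ partitionFunction n}

theorem lt_firstIndex_iff {n : ℕ} {y : ℝ} :
    n < firstIndex y ↔ (partitionFunction n : ℝ) < y := by
  constructor
  · intro h
    have := Nat.notMem_of_lt_sInf h
    simpa using this
  · intro h
    by_contra! hn
    have hne : {n : ℕ | y ≤ partitionFunction n}.Nonempty := by
      obtain ⟨N, hN⟩ := ((tendsto_partitionReal_atTop.comp
        tendsto_natCast_atTop_atTop).eventually_ge_atTop y).exists
      rw [Function.comp_apply, partitionReal_natCast] at hN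
      exact ⟨N, hN⟩
    have h1 : y ≤ partitionFunction (firstIndex y) := Nat.sInf_mem hne
    have h2 : (partitionFunction (firstIndex y) : ℝ) ≤ partitionFunction n := by
      exact_mod_cast partitionFunction_monotone hn
    linarith

theorem firstIndex_mono : Monotone firstIndex := by
  intro y z h
  by_contra! hlt
  have h1 := lt_firstIndex_iff.1 hlt
  exact (lt_irrefl _ (lt_firstIndex_iff.2 (h1.trans_le h)))

theorem lt_firstIndex_iff_real {x y : ℝ} (hx : 0 ≤ x) :
    x < firstIndex y ↔ partitionReal x < y := by
  rw [partitionReal_of_nonneg hx, ← lt_firstIndex_iff, Nat.floor_lt hx]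

theorem tendsto_firstIndex : Tendsto (fun y => (firstIndex y : ℝ)) atTop atTop := by
  refine tendsto_natCast_atTop_atTop.comp (tendsto_atTop.2 fun N => ?_)
  filter_upwards [eventually_gt_atTop (partitionFunction N : ℝ)] with y hy
  exact (lt_firstIndex_iff.2 hy).le

theorem le_partitionReal_firstIndex (y : ℝ) : y ≤ partitionReal (firstIndex y) := by
  have h := (lt_firstIndex_iff (n := firstIndex y) (y := y)).not.1 (lt_irrefl _)
  rw [partitionReal_natCast]
  exact not_lt.1 h

theorem tendsto_ratio_firstIndex (t : ℝ) :
    Tendsto (fun y => partitionRatio (firstIndex y) t) atTop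
      (𝓝 (Real.exp (growthRate * t))) :=
  (tendsto_partitionRatio t).comp tendsto_firstIndex

/-- The value of `p` at the first index with `p(n) ≥ y` is asymptotically at most `y`: with `N` that
index, `p(N - ε√N) < y`, and `p(N) / p(N - ε√N)` is close to `1` for small `ε`. -/
theorem partitionReal_firstIndex_le {μ : ℝ} (hμ : 1 < μ) :
    ∀ᶠ y in atTop, partitionReal (firstIndex y) ≤ μ * y := by
  have hC := growthRate_pos
  have hlog : 0 < Real.log μ := Real.log_pos hμ
  set ε := Real.log μ / (2 * growthRate) with hε
  have hε0 : 0 < ε := by positivity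
  have hlim : μ⁻¹ < Real.exp (growthRate * -ε) := by
    rw [← Real.exp_log (inv_pos.2 (by linarith : 0 < μ)), Real.log_inv]
    refine Real.exp_lt_exp.2 ?_
    have : growthRate * ε = Real.log μ / 2 := by rw [hε]; field_simp
    linarith
  filter_upwards [(tendsto_ratio_firstIndex (-ε)).eventually_const_lt hlim,
    tendsto_firstIndex.eventually_gt_atTop 0,
    ((tendsto_add_mul_sqrt_atTop (-ε)).comp tendsto_firstIndex).eventually_ge_atTop 0]
    with y h1 h2 h3
  simp only [Function.comp_apply] at h3
  have hs : 0 < √(firstIndex y : ℝ) := Real.sqrt_pos.2 h2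
  have h4 := (lt_firstIndex_iff_real (y := y) h3).1 (by nlinarith)
  rw [partitionReal_eq_ratio_mul h2.le] at h4
  have hP := partitionReal_pos h2.le
  have h5 := (mul_lt_mul_of_pos_right h1 hP).trans h4
  rw [inv_mul_lt_iff₀ (by linarith)] at h5
  exact h5.le

/-- The number of `n` with `y ≤ p(n) < r y`, measured in units of the square root of the first such
index. -/
theorem tendsto_firstIndex_sub {r : ℝ} (hr : 1 ≤ r) :
    Tendsto (fun y => ((firstIndex (r * y) : ℝ) - firstIndex y) / √(firstIndex y : ℝ)) atTop
      (𝓝 (Real.log r / growthRate)) := by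
  have hC := growthRate_pos
  have hr0 : 0 < r := by linarith
  refine tendsto_order.2 ⟨fun t ht => ?_, fun t' ht' => ?_⟩
  · rw [lt_div_iff₀ hC] at ht
    have h1 : Real.exp (growthRate * t) < r := by
      rw [← Real.lt_log_iff_exp_lt hr0]; linarith
    obtain ⟨ν, hν1, hν2⟩ := exists_between h1
    have hν0 : 0 < ν := (Real.exp_pos _).trans hν1
    filter_upwards [(tendsto_ratio_firstIndex t).eventually_lt_const hν1,
      partitionReal_firstIndex_le ((one_lt_div hν0).2 hν2),
      tendsto_firstIndex.eventually_gt_atTop 0,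
      ((tendsto_add_mul_sqrt_atTop t).comp tendsto_firstIndex).eventually_ge_atTop 0]
      with y h2 h3 h4 h5
    simp only [Function.comp_apply] at h5
    have hP := partitionReal_pos h4.le
    have h6 : partitionReal (firstIndex y + t * √(firstIndex y : ℝ)) < r * y := by
      rw [partitionReal_eq_ratio_mul h4.le]
      calc _ < ν * partitionReal (firstIndex y) := by gcongr
        _ ≤ ν * (r / ν * y) := by gcongr
        _ = r * y := by field_simp
    have h7 := (lt_firstIndex_iff_real h5).2 h6
    rw [lt_div_iff₀ (Real.sqrt_pos.2 h4)]
    linarith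
  · obtain ⟨t, ht, htt'⟩ := exists_between ht'
    rw [div_lt_iff₀ hC] at ht
    have h1 : r < Real.exp (growthRate * t) := by
      rw [← Real.log_lt_iff_lt_exp hr0]; linarith
    filter_upwards [(tendsto_ratio_firstIndex t).eventually_const_lt h1,
      tendsto_firstIndex.eventually_gt_atTop 0,
      ((tendsto_add_mul_sqrt_atTop t).comp tendsto_firstIndex).eventually_ge_atTop 0,
      eventually_ge_atTop 0] with y h2 h4 h5 h0
    simp only [Function.comp_apply] at h5
    have hP := partitionReal_pos h4.le
    have h6 : r * y ≤ partitionReal (firstIndex y + t * √(firstIndex y : ℝ)) := by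
      rw [partitionReal_eq_ratio_mul h4.le]
      exact mul_le_mul h2.le (le_partitionReal_firstIndex y) h0 (by linarith)
    have h7 := (lt_firstIndex_iff_real (y := r * y) h5).not.2 (not_lt.2 h6)
    rw [div_lt_iff₀ (Real.sqrt_pos.2 h4)]
    nlinarith [Real.sqrt_pos.2 h4]

/-! ### Leading digits -/

theorem digits_div_pow {k : ℕ} (hk : 2 ≤ k) (m j : ℕ) :
    Nat.digits k (m / k ^ j) = (Nat.digits k m).drop j := by
  induction j with
  | zero => simp
  | succ j ih =>
    rw [pow_succ, ← Nat.div_div_eq_div_mul, ← List.drop_drop, ← ih]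
    rcases Nat.eq_zero_or_pos (m / k ^ j) with h | h
    · simp [h]
    · rw [Nat.digits_def' (by omega) h]
      simp

theorem beginsWith_iff {k : ℕ} (hk : 2 ≤ k) (d m : ℕ) :
    BeginsWith k d m ↔ ∃ j, d * k ^ j ≤ m ∧ m < (d + 1) * k ^ j := by
  have h : ∀ j, (d * k ^ j ≤ m ∧ m < (d + 1) * k ^ j) ↔ m / k ^ j = d := fun j => by
    have hp : 0 < k ^ j := by positivity
    rw [Nat.div_eq_iff hp]
    have : (d + 1) * k ^ j = d * k ^ j + k ^ j := by ring
    omega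
  simp_rw [h]
  constructor
  · intro hs
    rw [BeginsWith, List.suffix_iff_eq_drop, ← digits_div_pow hk] at hs
    exact ⟨_, (Nat.digits_inj_iff.1 hs).symm⟩
  · rintro ⟨j, rfl⟩
    rw [BeginsWith, digits_div_pow hk]
    exact List.drop_suffix _ _

/-! ### Density of a union of intervals -/

theorem card_biUnion_Ico {a b : ℕ → ℕ} (hab : ∀ j, a j ≤ b j) (hba : ∀ j, b j ≤ a (j + 1))
    (J : ℕ) : (((range J).biUnion fun j => Ico (a j) (b j)).card : ℝ)
      = ∑ j ∈ range J, ((b j : ℝ) - a j) := by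
  have ha : Monotone a := monotone_nat_of_le_succ fun j => (hab j).trans (hba j)
  rw [Finset.card_biUnion]
  · push_cast
    refine Finset.sum_congr rfl fun j _ => ?_
    rw [Nat.card_Ico, Nat.cast_sub (hab j)]
  · have key : ∀ i j, i < j → Disjoint (Ico (a i) (b i)) (Ico (a j) (b j)) := fun i j hij => by
      refine Finset.disjoint_left.2 fun n hi hj => ?_
      have := ha (Nat.succ_le_of_lt hij)
      have := hba i
      simp only [mem_Ico] at hi hj
      simp only [Nat.succ_eq_add_one] at *
      omega
    intro i _ j _ hij
    rcases hij.lt_or_gt with h | h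
    · exact key i j h
    · exact (key j i h).symm

/-- If the blocks `[a j, a (j + 1))` satisfy `a (j + 1) ∼ a j`, and `[a j, b j)` takes up
asymptotically the proportion `L` of the `j`-th block, then `⋃ j, [a j, b j)` has density `L`. -/
theorem tendsto_density_iUnion_Ico {a b : ℕ → ℕ} {L : ℝ} (hab : ∀ j, a j ≤ b j)
    (hba : ∀ j, b j ≤ a (j + 1)) (ha : Tendsto (fun j => (a j : ℝ)) atTop atTop)
    (hsucc : Tendsto (fun j => (a (j + 1) : ℝ) / a j) atTop (𝓝 1))
    (hL : (fun j => ((b j : ℝ) - a j) - L * (a (j + 1) - a j))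
      =o[atTop] fun j => (a (j + 1) : ℝ) - a j) :
    Tendsto (fun x : ℝ => ({n : ℕ | (n : ℝ) ≤ x ∧ ∃ j, a j ≤ n ∧ n < b j}.ncard : ℝ) / x) atTop
      (𝓝 L) := by
  have ham : Monotone a := monotone_nat_of_le_succ fun j => (hab j).trans (hba j)
  set N : ℕ → ℝ := fun J => ∑ j ∈ range J, ((b j : ℝ) - a j) with hN
  have htel : ∀ J, ∑ j ∈ range J, ((a (j + 1) : ℝ) - a j) = a J - a 0 := fun J =>
    Finset.sum_range_sub (fun j => (a j : ℝ)) J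
  have hdiff : Tendsto (fun J => ∑ j ∈ range J, ((a (j + 1) : ℝ) - a j)) atTop atTop := by
    simp_rw [htel]
    exact tendsto_atTop_add_const_right _ _ ha
  have hNL : Tendsto (fun J => N J / a J) atTop (𝓝 L) := by
    have h1 := (hL.sum_range (fun j => sub_nonneg.2 (Nat.cast_le.2 (ham j.le_succ)))
      hdiff).tendsto_div_nhds_zero
    have h2 : Tendsto (fun J => ((a J : ℝ) - a 0) / a J) atTop (𝓝 1) := by
      have h3 : Tendsto (fun J => 1 - (a 0 : ℝ) / a J) atTop (𝓝 (1 - 0)) :=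
        (ha.const_div_atTop _).const_sub 1
      rw [sub_zero] at h3
      refine h3.congr' ?_
      filter_upwards [ha.eventually_gt_atTop 0] with J hJ
      field_simp
    have h4 := (h1.add_const L).mul h2
    rw [zero_add, mul_one] at h4
    refine h4.congr' ?_
    filter_upwards [ha.eventually_gt_atTop 0, hdiff.eventually_gt_atTop 0] with J hJ hJ2
    rw [htel] at hJ2
    rw [Finset.sum_sub_distrib, ← Finset.mul_sum, htel]
    field_simp
    ring
  -- `J x` is the index of the block containing `x`
  have hex : ∀ x : ℝ, ∃ j, x < a (j + 1) := fun x =>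
    (((tendsto_add_atTop_iff_nat 1).2 ha).eventually_gt_atTop x).exists
  classical
  set J : ℝ → ℕ := fun x => Nat.find (hex x) with hJ
  have hJlt : ∀ x, x < a (J x + 1) := fun x => Nat.find_spec (hex x)
  have hJle : ∀ x, (a 0 : ℝ) ≤ x → (a (J x) : ℝ) ≤ x := fun x hx => by
    rcases Nat.eq_zero_or_pos (J x) with h | h
    · rwa [h]
    · have := Nat.find_min (hex x) (Nat.sub_lt h one_pos : J x - 1 < J x)
      rwa [Nat.sub_add_cancel h, not_lt] at this
  have hJtop : Tendsto J atTop atTop := by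
    refine tendsto_atTop.2 fun M => ?_
    filter_upwards [eventually_ge_atTop (a M : ℝ)] with x hx
    have h1 : (a M : ℝ) < a (J x + 1) := hx.trans_lt (hJlt x)
    by_contra! h2
    have h3 : a (J x + 1) ≤ a M := ham h2
    have : (a (J x + 1) : ℝ) ≤ a M := by exact_mod_cast h3
    linarith
  have hlow : Tendsto (fun J => N J / a (J + 1)) atTop (𝓝 L) := by
    have h := hNL.div hsucc one_ne_zero
    rw [div_one] at h
    refine h.congr' ?_
    filter_upwards [ha.eventually_gt_atTop 0] with J hJ
    simp only [Pi.div_apply]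
    field_simp
  have hupp : Tendsto (fun J => N (J + 1) / a J) atTop (𝓝 L) := by
    have h := ((tendsto_add_atTop_iff_nat 1).2 hNL).mul hsucc
    rw [mul_one] at h
    refine h.congr' ?_
    filter_upwards [((tendsto_add_atTop_iff_nat 1).2 ha).eventually_gt_atTop 0] with J hJ
    field_simp
  have hN0 : ∀ J, 0 ≤ N J := fun J => Finset.sum_nonneg fun j _ =>
    sub_nonneg.2 (by exact_mod_cast hab j)
  refine tendsto_of_tendsto_of_tendsto_of_le_of_le' (hlow.comp hJtop) (hupp.comp hJtop) ?_ ?_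
  · filter_upwards [eventually_ge_atTop (a 0 : ℝ), eventually_gt_atTop 0] with x hx hx0
    simp only [Function.comp_apply]
    have hfin : {n : ℕ | (n : ℝ) ≤ x ∧ ∃ j, a j ≤ n ∧ n < b j}.Finite :=
      (Set.finite_Iic ⌊x⌋₊).subset fun n hn => (Nat.le_floor_iff hx0.le).2 hn.1
    have hsub : (((range (J x)).biUnion fun j => Ico (a j) (b j) : Finset ℕ) : Set ℕ)
        ⊆ {n : ℕ | (n : ℝ) ≤ x ∧ ∃ j, a j ≤ n ∧ n < b j} := by
      intro n hn
      simp only [coe_biUnion, Set.mem_iUnion, mem_coe, mem_range, mem_Ico] at hn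
      obtain ⟨j, hj, hn⟩ := hn
      refine ⟨?_, j, hn⟩
      have h1 : n ≤ a (J x) := (hn.2.le.trans (hba j)).trans (ham hj)
      exact le_trans (by exact_mod_cast h1) (hJle x hx)
    have h1 := Set.ncard_le_ncard hsub hfin
    rw [Set.ncard_coe_finset] at h1
    have h2 : N (J x) ≤ ({n : ℕ | (n : ℝ) ≤ x ∧ ∃ j, a j ≤ n ∧ n < b j}.ncard : ℝ) := by
      rw [hN]
      simp only
      rw [← card_biUnion_Ico hab hba]
      exact_mod_cast h1
    exact div_le_div₀ (Nat.cast_nonneg _) h2 hx0 (hJlt x).le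
  · filter_upwards [eventually_ge_atTop (a 0 : ℝ),
      (ha.comp hJtop).eventually_gt_atTop 0] with x hx hJ0
    simp only [Function.comp_apply] at hJ0 ⊢
    have hsub : {n : ℕ | (n : ℝ) ≤ x ∧ ∃ j, a j ≤ n ∧ n < b j}
        ⊆ (((range (J x + 1)).biUnion fun j => Ico (a j) (b j) : Finset ℕ) : Set ℕ) := by
      rintro n ⟨hnx, j, hn⟩
      simp only [coe_biUnion, Set.mem_iUnion, mem_coe, mem_range, mem_Ico]
      refine ⟨j, ?_, hn⟩
      by_contra! hj
      have h1 : a (J x + 1) ≤ n := (ham hj).trans hn.1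
      have h2 : (a (J x + 1) : ℝ) ≤ n := by exact_mod_cast h1
      linarith [hJlt x]
    have h1 := Set.ncard_le_ncard hsub (Finset.finite_toSet _)
    rw [Set.ncard_coe_finset] at h1
    have h2 : ({n : ℕ | (n : ℝ) ≤ x ∧ ∃ j, a j ≤ n ∧ n < b j}.ncard : ℝ) ≤ N (J x + 1) := by
      rw [hN]
      simp only
      rw [← card_biUnion_Ico hab hba]
      exact_mod_cast h1
    exact div_le_div₀ (hN0 _) h2 hJ0 (hJle x hx)

/-! ### The partition function is Benford -/

theorem corollary1p2 : IsBenford partitionFunction := by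
  intro k hk d hd
  have hC := growthRate_pos
  have hk0 : (0 : ℝ) < k := by positivity
  have hk1 : (1 : ℝ) < k := by exact_mod_cast hk
  have hd1 : (1 : ℝ) ≤ d := by exact_mod_cast hd
  have hd0 : (0 : ℝ) < d := by linarith
  have hlogk : 0 < Real.log k := Real.log_pos hk1
  set y : ℕ → ℝ := fun j => d * (k : ℝ) ^ j with hy
  have hytop : Tendsto y atTop atTop :=
    (tendsto_pow_atTop_atTop_of_one_lt hk1).const_mul_atTop hd0
  set a : ℕ → ℕ := fun j => firstIndex (y j) with ha
  set b : ℕ → ℕ := fun j => firstIndex ((d + 1) / d * y j) with hb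
  have hyb : ∀ j, (d + 1) / d * y j = (d + 1) * (k : ℝ) ^ j := fun j => by
    rw [hy]; field_simp
  have hys : ∀ j, y (j + 1) = k * y j := fun j => by
    simp only [hy]; ring
  have hab : ∀ j, a j ≤ b j := fun j => firstIndex_mono (by
    rw [hyb]
    simp only [hy]
    gcongr
    linarith)
  have hba : ∀ j, b j ≤ a (j + 1) := fun j => firstIndex_mono (by
    rw [hyb, hys]
    simp only [hy]
    rw [← mul_assoc]
    have hk2 : (2 : ℝ) ≤ k := by exact_mod_cast hk
    gcongr
    nlinarith)
  have hatop : Tendsto (fun j => (a j : ℝ)) atTop atTop := tendsto_firstIndex.comp hytop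
  have hA : Tendsto (fun j => ((a (j + 1) : ℝ) - a j) / √(a j : ℝ)) atTop
      (𝓝 (Real.log k / growthRate)) := by
    refine ((tendsto_firstIndex_sub hk1.le).comp hytop).congr fun j => ?_
    simp only [Function.comp_apply, ha, hys]
  have hB : Tendsto (fun j => ((b j : ℝ) - a j) / √(a j : ℝ)) atTop
      (𝓝 (Real.log ((d + 1) / d) / growthRate)) :=
    (tendsto_firstIndex_sub ((one_le_div hd0).2 (by linarith))).comp hytop
  have hsucc : Tendsto (fun j => (a (j + 1) : ℝ) / a j) atTop (𝓝 1) := by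
    have h1 := (hA.mul (tendsto_inv_atTop_zero.comp
      (Real.tendsto_sqrt_atTop.comp hatop))).add_const 1
    rw [mul_zero, zero_add] at h1
    refine h1.congr' ?_
    filter_upwards [hatop.eventually_gt_atTop 0] with j hj
    have hs := Real.mul_self_sqrt hj.le
    have hs0 := (Real.sqrt_pos.2 hj).ne'
    simp only [Function.comp_apply]
    rw [← div_eq_mul_inv, div_div, hs]
    field_simp
    ring
  set L := Real.logb (k : ℝ) ((d : ℝ) + 1) - Real.logb (k : ℝ) (d : ℝ) with hLdef
  have hLe : Real.log ((d + 1) / d) / growthRate / (Real.log k / growthRate) = L := by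
    rw [hLdef, Real.logb, Real.logb, Real.log_div (by positivity) hd0.ne']
    field_simp
  have hL : (fun j => ((b j : ℝ) - a j) - L * (a (j + 1) - a j))
      =o[atTop] fun j => (a (j + 1) : ℝ) - a j := by
    have hlim := (hB.div hA (div_pos hlogk hC).ne').sub_const L
    rw [hLe, sub_self] at hlim
    have hpos : ∀ᶠ j in atTop, 0 < ((a (j + 1) : ℝ) - a j) / √(a j : ℝ) :=
      hA.eventually_const_lt (div_pos hlogk hC)
    have hne : ∀ᶠ j in atTop, (a (j + 1) : ℝ) - a j ≠ 0 := hpos.mono fun j hj h0 => by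
      rw [h0, zero_div] at hj
      exact lt_irrefl _ hj
    refine (Asymptotics.isLittleO_iff_tendsto' (hne.mono fun j hj h0 => absurd h0 hj)).2
      (hlim.congr' ?_)
    filter_upwards [hne, hatop.eventually_gt_atTop 0] with j hj hj0
    have hs0 := (Real.sqrt_pos.2 hj0).ne'
    simp only [Pi.div_apply]
    field_simp
  refine (tendsto_density_iUnion_Ico hab hba hatop hsucc hL).congr fun x => ?_
  rw [digitFrequency]
  congr 3
  ext n
  simp only [Set.mem_ofPred_eq, beginsWith_iff hk]
  refine and_congr_right fun _ => exists_congr fun j => ?_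
  rw [← not_lt, ha, hb, lt_firstIndex_iff, lt_firstIndex_iff, hyb, not_lt]
  simp only [hy]
  norm_cast
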